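/- **Spanning clan embedding into trees.** All logarithms are to base $2$. Let $G=(V,E,w)$ be a finite connected undirected graph with edge weights $w:E\to\mathbb{R}_{\ge 0}$ and shortest path distance $d_G$. A *spanning clan embedding* of $G$ into a weighted tree $T$ (with shortest path distance $d_T$) is a pair $(f,\chi)$, where $f$ assigns to each $v\in V$ a nonempty set $f(v)\subseteq V(T)$ (the copies of $v$) and $\chi:V\to V(T)$ satisfies $\chi(v)\in f(v)$, such that: the sets $f(v)$, $v\in V$, are pairwise disjoint and cover $V(T)$; $d_T(u',v')\ge d_G(u,v)$ for all $u,v\in V$, $u'\in f(u)$, $v'\in f(v)$; and for every edge $\{u',v'\}$ of $T$ with $u'\in f(u)$, $v'\in f(v)$, the pair $\{u,v\}$ is an edge of $G$ and $w_T(u',v')=w(u,v)$. It has *multiplicative distortion* $t$ if $\min_{v'\in f(v)} d_T(v',\chi(u))\le t\cdot d_G(u,v)$ for all $u,v\in V$. There is a universal constant $C>0$ such that for every $n\ge 3$ and every connected $n$-vertex weighted graph $G=(V,E,w)$ as above: 1. for every $\epsilon\in(0,1]$ there is a probability distribution $\mathcal{D}$ over spanning clan embeddings $(f,\chi)$ of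 $G$ into trees, all with multiplicative distortion $C\cdot\frac{\log n\cdot\log\log n}{\epsilon}$, such that $\mathbb{E}_{(f,\chi)\sim\mathcal{D}}[|f(v)|]\le 1+\epsilon$ for every $v\in V$; 2. for every integer $k\ge 1$ there is a probability distribution $\mathcal{D}$ over spanning clan embeddings $(f,\chi)$ of $G$ into trees, all with multiplicative distortion $C\cdot k\log\log n$, such that $\mathbb{E}_{(f,\chi)\sim\mathcal{D}}[|f(v)|]\le C\cdot n^{1/k}$ for every $v\in V$. -/

import Mathlib

open scoped ENNReal

universe u

/-- An undirected (simple) graph on the vertex set `V` with nonnegative edge weights.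
The value of `weight` off the edge set is irrelevant. -/
structure WeightedGraph (V : Type*) where
  graph : SimpleGraph V
  weight : Sym2 V → ℝ
  weight_nonneg : ∀ e ∈ graph.edgeSet, 0 ≤ weight e

namespace WeightedGraph

variable {V : Type*}

/-- Total weight of the edges traversed by a walk (with multiplicity). -/
def walkLength (G : WeightedGraph V) {x y : V} (p : G.graph.Walk x y) : ℝ :=
  (p.edges.map G.weight).sum

/-- Shortest path distance `d_G`; only used for connected graphs, so that the infimum is over a
nonempty set of nonnegative reals. -/
noncomputable def dist (G : WeightedGraph V) (x y : V) : ℝ :=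
  ⨅ p : G.graph.Walk x y, G.walkLength p

end WeightedGraph

/-- `f` maps every point to a nonempty set of copies (its clan), and clans of distinct points are
disjoint. -/
structure IsOneToMany {X Y : Type*} (f : X → Finset Y) : Prop where
  nonempty : ∀ x, (f x).Nonempty
  disjoint : ∀ x y, x ≠ y → Disjoint (f x) (f y)

/-- Distances between copies are at least the original distances. -/
def IsDominating {X Y : Type*} (dX : X → X → ℝ) (dY : Y → Y → ℝ) (f : X → Finset Y) : Prop :=
  ∀ x y, ∀ x' ∈ f x, ∀ y' ∈ f y, dX x y ≤ dY x' y'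

/-- `(f, χ)` is a clan embedding of `(X, dX)` into `(Y, dY)`, with clans `f x` and chiefs `χ x`. -/
structure IsClanEmbedding {X Y : Type*} (dX : X → X → ℝ) (dY : Y → Y → ℝ)
    (f : X → Finset Y) (χ : X → Y) : Prop where
  oneToMany : IsOneToMany f
  dominating : IsDominating dX dY f
  chief_mem : ∀ x, χ x ∈ f x

/-- Multiplicative distortion `t`: for all `x, y`, the minimum over the copies `y'` of `y` of the
distance between `y'` and the chief of `x` is at most `t * dX x y`. -/
def HasMultDistortion {X Y : Type*} (dX : X → X → ℝ) (dY : Y → Y → ℝ)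
    (f : X → Finset Y) (χ : X → Y) (t : ℝ) : Prop :=
  ∀ x y, ∃ y' ∈ f y, dY y' (χ x) ≤ t * dX x y

/-- A one-to-many embedding between weighted graphs is spanning if every vertex of `H` is a copy
of a vertex of `G`, and every edge of `H` is a copy of an edge of `G` of the same weight. -/
structure IsSpanning {V W : Type*} (G : WeightedGraph V) (H : WeightedGraph W)
    (f : V → Finset W) : Prop where
  onto : ∀ w, ∃ v, w ∈ f v
  edges : ∀ u' v', H.graph.Adj u' v' → ∀ u v, u' ∈ f u → v' ∈ f v →
    G.graph.Adj u v ∧ H.weight s(u', v') = G.weight s(u, v)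

/-- A spanning clan embedding of `G` into a finite weighted tree (with vertices `0, …, m - 1`). -/
structure SpanningClanTree {V : Type*} (G : WeightedGraph V) where
  m : ℕ
  T : WeightedGraph (Fin m)
  isTree : T.graph.IsTree
  f : V → Finset (Fin m)
  χ : V → Fin m
  isClan : IsClanEmbedding G.dist T.dist f χ
  isSpanning : IsSpanning G T f

/-- The embedding has multiplicative distortion at most `t`. -/
def SpanningClanTree.HasDistortion {V : Type*} {G : WeightedGraph V} (e : SpanningClanTree G)
    (t : ℝ) : Prop :=
  HasMultDistortion G.dist e.T.dist e.f e.χ t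

/-- The expected number `𝔼 |f(v)|` of copies of `v` when `(f, χ)` is drawn from `D`. -/
noncomputable def expectedClanSize {V : Type*} {G : WeightedGraph V}
    (D : PMF (SpanningClanTree G)) (v : V) : ℝ≥0∞ :=
  ∑' e, D e * ((e.f v).card : ℝ≥0∞)

/-! By minimax it suffices to find, for every probability vector `μ` on the vertices, one tree of
the required distortion in which the `μ`-average number of copies is small
(`exists_pmf_expectation_le`). For vertex weights `ν ≥ 1` of total `N ≤ 2 ^ 2 ^ l`, such a tree is
built by petal decomposition with overlapping parts (`exists_cover`).

A cluster `Y` with center `x` is split into a petal of radius `r'` around the end of a shortest path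
from `x`, and the complement of the concentric petal of a smaller radius `r`. Vertices in between go
to both parts and are duplicated. Both parts are covered recursively, and the trees are joined by
the edge through which the path enters the large petal.

Number of copies: region growing (`exists_sparse_cut`) gives radii for which the sum of `ν(part) ^
(1 + 1/k)` over both parts is at most `ν(Y) ^ (1 + 1/k)`. This potential bounds the weighted number
of copies. About `k * l` candidate radii suffice because `log (N / ν)` changes by a factor `1 + 1/k`
per failed step, which accounts for the `log log n`.

Distortion: the chief of a vertex is chosen by the radius halfway between `r` and `r'`. A walk
leaving the part of its chief thus has length at least a constant times `D / (k * l)`, where `D` is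
comparable to the radius of `Y`. The joined tree has radius `O(D)`, so such a walk is stretched by
`O(k * l)`; other walks are left to the recursion (`hasStretch_join`).

Radius: distances from the root must not accumulate constant factors over the levels of recursion.
When a petal around a farthest point is cut off, the weights on its ray are halved in the new
cluster, which pays for the detour through the portal. That ray is then protected: later petals
either avoid it or are centered at its end, so no edge is halved twice. This keeps true tree
distances within a factor 4 of the current ones, and within a factor 2 along the protected ray. -/

open SimpleGraph

namespace ClanTree

/-! ### Walk lengths, shortest paths inside a vertex set, and rays. -/

section

variable {V : Type u} {H : SimpleGraph V} {w : Sym2 V → ℝ} {x y z : V} {Y : Finset V}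

/-- Total weight of the edges of a walk, with multiplicity. -/
def wlen (w : Sym2 V → ℝ) (p : H.Walk x y) : ℝ := (p.edges.map w).sum

@[simp] lemma wlen_nil : wlen w (Walk.nil : H.Walk x x) = 0 := by simp [wlen]

@[simp] lemma wlen_cons (h : H.Adj x y) (p : H.Walk y z) :
    wlen w (Walk.cons h p) = w s(x, y) + wlen w p := by simp [wlen]

@[simp] lemma wlen_append (p : H.Walk x y) (q : H.Walk y z) :
    wlen w (p.append q) = wlen w p + wlen w q := by simp [wlen]

@[simp] lemma wlen_concat (p : H.Walk x y) (h : H.Adj y z) :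
    wlen w (p.concat h) = wlen w p + w s(y, z) := by simp [Walk.concat_eq_append]

@[simp] lemma wlen_reverse (p : H.Walk x y) : wlen w p.reverse = wlen w p := by
  simp [wlen, List.sum_reverse]

lemma wlen_map {W : Type*} {T : SimpleGraph W} (f : T →g H) {a b : W} (p : T.Walk a b) :
    wlen w (p.map f) = wlen (fun e => w (Sym2.map f e)) p := by
  simp [wlen, Function.comp_def]

lemma wlen_nonneg (hw : ∀ e, 0 ≤ w e) (p : H.Walk x y) : 0 ≤ wlen w p :=
  List.sum_nonneg (by simpa using fun e _ => hw e)

lemma wlen_mono {w' : Sym2 V → ℝ} (h : ∀ e, w e ≤ w' e) (p : H.Walk x y) :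
    wlen w p ≤ wlen w' p :=
  List.sum_le_sum fun e _ => h e

lemma wlen_smul (c : ℝ) (p : H.Walk x y) : wlen (fun e => c * w e) p = c * wlen w p := by
  simp [wlen, List.sum_map_mul_left]

lemma wlen_eq_zero (p : H.Walk x y) (h : ∀ e ∈ p.edges, w e = 0) : wlen w p = 0 := by
  unfold wlen
  rw [List.map_congr_left h]
  simp

/-- All vertices of the walk lie in `Y`. -/
def Inside (Y : Finset V) (p : H.Walk x y) : Prop := ∀ z ∈ p.support, z ∈ Y

lemma Inside.append {p : H.Walk x y} {q : H.Walk y z} (hp : Inside Y p) (hq : Inside Y q) :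
    Inside Y (p.append q) := fun a ha => by
  rcases Walk.mem_support_append_iff _ _ |>.1 ha with h | h
  exacts [hp _ h, hq _ h]

lemma Inside.reverse {p : H.Walk x y} (hp : Inside Y p) : Inside Y p.reverse :=
  fun a ha => hp a (by simpa using ha)

lemma Inside.mono {Y' : Finset V} (h : Y ⊆ Y') {p : H.Walk x y} (hp : Inside Y p) : Inside Y' p :=
  fun a ha => h (hp a ha)

/-- Removing cycles does not increase length when weights are nonnegative, and the length of a path
is determined by its edge set, so only finitely many lengths compete. -/
lemma exists_shortest [Finite V] (hw : ∀ e, 0 ≤ w e) (h : ∃ p : H.Walk x y, Inside Y p) :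
    ∃ p : H.Walk x y, Inside Y p ∧ ∀ p' : H.Walk x y, Inside Y p' → wlen w p ≤ wlen w p' := by
  classical
  have := Fintype.ofFinite V
  let S : Set ℝ := {l | ∃ p : H.Walk x y, Inside Y p ∧ p.IsPath ∧ wlen w p = l}
  have hfin : S.Finite := by
    refine (Set.finite_range fun s : Finset (Sym2 V) => ∑ e ∈ s, w e).subset ?_
    rintro l ⟨p, -, hp, rfl⟩
    exact ⟨p.edges.toFinset, List.sum_toFinset w hp.isTrail.edges_nodup⟩
  have hby : ∀ p : H.Walk x y, Inside Y p → Inside Y p.bypass ∧ wlen w p.bypass ≤ wlen w p :=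
    fun p hp => ⟨fun a ha => hp a (p.support_bypass_subset_support ha),
      List.Sublist.sum_le_sum (p.edges_bypass_sublist_edges.map w)
        (by simpa using fun e _ => hw e)⟩
  obtain ⟨p₀, hp₀⟩ := h
  have hne : S.Nonempty := ⟨_, p₀.bypass, (hby p₀ hp₀).1, p₀.bypass_isPath, rfl⟩
  obtain ⟨l, ⟨p, hp, -, rfl⟩, hmin⟩ := hfin.exists_minimal hne
  refine ⟨p, hp, fun p' hp' => ?_⟩
  by_contra! hlt
  have := hby p' hp'
  have := hmin ⟨_, this.1, p'.bypass_isPath, rfl⟩ (by linarith)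
  linarith

/-- Shortest path distance inside `Y`. -/
noncomputable def cdist (H : SimpleGraph V) (w : Sym2 V → ℝ) (Y : Finset V) (x y : V) : ℝ :=
  sInf {l | ∃ p : H.Walk x y, Inside Y p ∧ wlen w p = l}

/-- `Y` induces a connected subgraph of `H`. -/
def IsConn (H : SimpleGraph V) (Y : Finset V) : Prop :=
  ∀ x ∈ Y, ∀ y ∈ Y, ∃ p : H.Walk x y, Inside Y p

lemma IsConn.of_center (h : ∀ y ∈ Y, ∃ p : H.Walk x y, Inside Y p) : IsConn H Y := by
  intro a ha b hb
  obtain ⟨p, hp⟩ := h a ha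
  obtain ⟨q, hq⟩ := h b hb
  exact ⟨p.reverse.append q, hp.reverse.append hq⟩

lemma cdist_nonneg (hw : ∀ e, 0 ≤ w e) : 0 ≤ cdist H w Y x y :=
  Real.sInf_nonneg (by rintro l ⟨p, -, rfl⟩; exact wlen_nonneg hw p)

lemma cdist_le (hw : ∀ e, 0 ≤ w e) {p : H.Walk x y} (hp : Inside Y p) :
    cdist H w Y x y ≤ wlen w p :=
  csInf_le ⟨0, by rintro l ⟨p, -, rfl⟩; exact wlen_nonneg hw p⟩ ⟨p, hp, rfl⟩

lemma le_cdist (hc : IsConn H Y) (hx : x ∈ Y) (hy : y ∈ Y) {c : ℝ}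
    (h : ∀ p : H.Walk x y, Inside Y p → c ≤ wlen w p) : c ≤ cdist H w Y x y := by
  obtain ⟨p, hp⟩ := hc x hx y hy
  exact le_csInf ⟨_, p, hp, rfl⟩ (by rintro l ⟨p, hp, rfl⟩; exact h p hp)

lemma exists_geodesic [Finite V] (hw : ∀ e, 0 ≤ w e) (hc : IsConn H Y) (hx : x ∈ Y) (hy : y ∈ Y) :
    ∃ p : H.Walk x y, Inside Y p ∧ wlen w p = cdist H w Y x y := by
  obtain ⟨p, hp, hmin⟩ := exists_shortest hw (hc x hx y hy)
  exact ⟨p, hp, le_antisymm (le_cdist hc hx hy hmin) (cdist_le hw hp)⟩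

lemma cdist_self (hw : ∀ e, 0 ≤ w e) (hx : x ∈ Y) : cdist H w Y x x = 0 :=
  le_antisymm ((cdist_le hw (p := Walk.nil) (by simpa [Inside] using hx)).trans_eq wlen_nil)
    (cdist_nonneg hw)

lemma cdist_comm : cdist H w Y x y = cdist H w Y y x := by
  unfold cdist
  congr 1
  ext l
  constructor
  all_goals
    rintro ⟨p, hp, rfl⟩
    exact ⟨p.reverse, hp.reverse, by simp⟩

lemma cdist_triangle [Finite V] (hw : ∀ e, 0 ≤ w e) (hc : IsConn H Y) (hx : x ∈ Y) (hy : y ∈ Y)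
    (hz : z ∈ Y) : cdist H w Y x z ≤ cdist H w Y x y + cdist H w Y y z := by
  obtain ⟨p, hp, hpl⟩ := exists_geodesic hw hc hx hy
  obtain ⟨q, hq, hql⟩ := exists_geodesic hw hc hy hz
  rw [← hpl, ← hql, ← wlen_append]
  exact cdist_le hw (hp.append hq)

lemma cdist_add_cdist_le (hw : ∀ e, 0 ≤ w e) {p : H.Walk x y} (hp : Inside Y p)
    (hz : z ∈ p.support) : cdist H w Y x z + cdist H w Y z y ≤ wlen w p := by
  classical
  rw [← p.take_spec hz, wlen_append]
  exact add_le_add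
    (cdist_le hw fun a ha => hp a (p.support_takeUntil_subset_support hz ha))
    (cdist_le hw fun a ha => hp a (p.support_dropUntil_subset_support hz ha))

lemma cdist_le_of_mem_support (hw : ∀ e, 0 ≤ w e) {p : H.Walk x y} (hp : Inside Y p)
    (hz : z ∈ p.support) : cdist H w Y x z ≤ wlen w p := by
  have := cdist_add_cdist_le hw hp hz
  have := cdist_nonneg (H := H) (Y := Y) (x := z) (y := y) hw
  linarith

lemma cdist_add_cdist [Finite V] (hw : ∀ e, 0 ≤ w e) (hc : IsConn H Y) {p : H.Walk x y}
    (hp : Inside Y p) (hl : wlen w p = cdist H w Y x y) (hz : z ∈ p.support) :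
    cdist H w Y x z + cdist H w Y z y = cdist H w Y x y :=
  le_antisymm ((cdist_add_cdist_le hw hp hz).trans_eq hl)
    (cdist_triangle hw hc (hp _ p.start_mem_support) (hp _ hz) (hp _ p.end_mem_support))

lemma cdist_anti (hw : ∀ e, 0 ≤ w e) {Y' : Finset V} (hY : Y' ⊆ Y) (hc : IsConn H Y') (hx : x ∈ Y')
    (hy : y ∈ Y') : cdist H w Y x y ≤ cdist H w Y' x y :=
  le_cdist hc hx hy fun _ hp => cdist_le hw (hp.mono hY)

/-- `q 0, …, q m` is a shortest path inside `Y` that starts at `x`. -/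
structure IsRay (H : SimpleGraph V) (w : Sym2 V → ℝ) (Y : Finset V) (x : V) (q : ℕ → V) (m : ℕ) :
    Prop where
  zero : q 0 = x
  mem : ∀ i ≤ m, q i ∈ Y
  adj : ∀ i < m, H.Adj (q i) (q (i + 1))
  dist : ∀ i < m, cdist H w Y x (q (i + 1)) = cdist H w Y x (q i) + w s(q i, q (i + 1))

/-- Every prefix of a shortest walk is itself shortest, which makes the distances from `x` additive
along its edges. -/
lemma exists_ray_of_geodesic [Finite V] (hw : ∀ e, 0 ≤ w e) (p : H.Walk x y) (hp : Inside Y p)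
    (hl : wlen w p = cdist H w Y x y) : ∃ q m, IsRay H w Y x q m ∧ q m = y := by
  induction p using Walk.concatRec with
  | Hnil => exact ⟨fun _ => _, 0, ⟨rfl, fun i _ => hp _ (by simp), by simp, by simp⟩, rfl⟩
  | @Hconcat a b c p h ih =>
    have hp' : Inside Y p := fun z hz => hp z (by simp [Walk.support_concat, hz])
    have hb : b ∈ Y := hp' _ p.end_mem_support
    have hcY : c ∈ Y := hp _ (by simp [Walk.support_concat])
    rw [wlen_concat] at hl
    have h1 := cdist_le hw hp'
    obtain ⟨s, hs, hsl⟩ : ∃ s : H.Walk a b, Inside Y s ∧ wlen w s = cdist H w Y a b := by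
      obtain ⟨s, hs, hmin⟩ := exists_shortest hw ⟨p, hp'⟩
      exact ⟨s, hs, le_antisymm (le_csInf ⟨_, p, hp', rfl⟩
        (by rintro l ⟨t, ht, rfl⟩; exact hmin t ht)) (cdist_le hw hs)⟩
    have h2 : cdist H w Y a c ≤ cdist H w Y a b + w s(b, c) := by
      rw [← hsl, ← wlen_concat s h]
      refine cdist_le hw ?_
      intro z hz
      rw [Walk.support_concat, List.mem_append] at hz
      rcases hz with hz | hz
      · exact hs z hz
      · simp only [List.mem_singleton] at hz
        exact hz ▸ hcY
    obtain ⟨q, m, hq, hqm⟩ := ih hp' (by linarith)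
    refine ⟨fun i => if i ≤ m then q i else c, m + 1, ⟨by simp [hq.zero], ?_, ?_, ?_⟩, by simp⟩
    · intro i _
      by_cases hi : i ≤ m
      · simpa [hi] using hq.mem i hi
      · simpa [hi] using hcY
    · intro i hi
      rcases Nat.lt_succ_iff_lt_or_eq.1 hi with hi | rfl
      · simpa [hi.le, Nat.succ_le_of_lt hi] using hq.adj i hi
      · simpa [hqm] using h
    · intro i hi
      rcases Nat.lt_succ_iff_lt_or_eq.1 hi with hi | rfl
      · simpa [hi.le, Nat.succ_le_of_lt hi] using hq.dist i hi
      · simp only [le_refl, ↓reduceIte, hqm, Nat.not_succ_le_self]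
        linarith

lemma exists_ray [Finite V] (hw : ∀ e, 0 ≤ w e) (hc : IsConn H Y) (hx : x ∈ Y) (hy : y ∈ Y) :
    ∃ q m, IsRay H w Y x q m ∧ q m = y := by
  obtain ⟨p, hp, hl⟩ := exists_geodesic hw hc hx hy
  exact exists_ray_of_geodesic hw p hp hl

namespace IsRay

variable {q : ℕ → V} {m : ℕ}

lemma dist_mono (hw : ∀ e, 0 ≤ w e) (hq : IsRay H w Y x q m) {i j : ℕ} (hij : i ≤ j) (hj : j ≤ m) :
    cdist H w Y x (q i) ≤ cdist H w Y x (q j) := by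
  induction j, hij using Nat.le_induction with
  | base => exact le_rfl
  | succ j _ ih =>
    rw [hq.dist j hj]
    have := hw s(q j, q (j + 1))
    have := ih (by omega)
    linarith

lemma sum_eq (hq : IsRay H w Y x q m) {i j : ℕ} (hij : i ≤ j) (hj : j ≤ m) :
    ∑ l ∈ Finset.Ico i j, w s(q l, q (l + 1)) =
      cdist H w Y x (q j) - cdist H w Y x (q i) := by
  induction j, hij using Nat.le_induction with
  | base => simp
  | succ j hij ih =>
    rw [Finset.sum_Ico_succ_top hij, ih (by omega), hq.dist j hj]
    ring

lemma exists_walk (hq : IsRay H w Y x q m) {i j : ℕ} (hij : i ≤ j) (hj : j ≤ m) :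
    ∃ p : H.Walk (q i) (q j), (∀ z ∈ p.support, ∃ l, i ≤ l ∧ l ≤ j ∧ z = q l) ∧
      ∀ w' : Sym2 V → ℝ, wlen w' p = ∑ l ∈ Finset.Ico i j, w' s(q l, q (l + 1)) := by
  induction j, hij using Nat.le_induction with
  | base => exact ⟨Walk.nil, by simpa using ⟨i, le_rfl, le_rfl, rfl⟩, by simp⟩
  | succ j hij ih =>
    obtain ⟨p, hp, hl⟩ := ih (by omega)
    refine ⟨p.concat (hq.adj j hj), ?_, fun w' => ?_⟩
    · intro z hz
      rw [Walk.support_concat, List.mem_append] at hz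
      rcases hz with hz | hz
      · obtain ⟨l, h1, h2, h3⟩ := hp z hz
        exact ⟨l, h1, by omega, h3⟩
      · simp only [List.mem_singleton] at hz
        exact ⟨j + 1, by omega, le_rfl, hz⟩
    · rw [wlen_concat, hl, Finset.sum_Ico_succ_top hij]

end IsRay

end

/-! ### Petals, their complements, and distances in both. -/

section

variable {V : Type u} {H : SimpleGraph V} {w : Sym2 V → ℝ} {x z z' : V} {Y : Finset V}
  {q : ℕ → V} {m : ℕ} {r r' : ℝ}

/-- `z` is in the petal of radius `r` around the end `q m` of the ray `q`: the union of the cones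
(with respect to `x`) around the points of the ray at distance at most `r` from its end. -/
def InPetal (H : SimpleGraph V) (w : Sym2 V → ℝ) (Y : Finset V) (x : V) (q : ℕ → V) (m : ℕ)
    (r : ℝ) (z : V) : Prop :=
  ∃ i ≤ m, cdist H w Y x (q m) + cdist H w Y x (q i) + 2 * cdist H w Y (q i) z
    - 2 * cdist H w Y x z ≤ r

open Classical in
/-- The petal of radius `r` as a subset of `Y`. -/
noncomputable def petal (H : SimpleGraph V) (w : Sym2 V → ℝ) (Y : Finset V) (x : V) (q : ℕ → V)
    (m : ℕ) (r : ℝ) : Finset V :=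
  Y.filter (InPetal H w Y x q m r)

lemma mem_petal : z ∈ petal H w Y x q m r ↔ z ∈ Y ∧ InPetal H w Y x q m r z := by
  simp [petal]

lemma petal_subset : petal H w Y x q m r ⊆ Y := fun _ h => (mem_petal.1 h).1

lemma InPetal.mono (h : r ≤ r') (hz : InPetal H w Y x q m r z) : InPetal H w Y x q m r' z := by
  obtain ⟨i, hi, hz⟩ := hz
  exact ⟨i, hi, hz.trans h⟩

variable [Finite V] (hw : ∀ e, 0 ≤ w e) (hc : IsConn H Y) (hx : x ∈ Y)
include hw hc hx

/-- The triangle inequality bounds the petal expression below by the difference of the distances of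
`q m` and `z` from `x`. This keeps the center, the early part of the ray and any short protected ray
out of the petal. -/
lemma not_inPetal (hq : IsRay H w Y x q m) (hz : z ∈ Y)
    (h : r < cdist H w Y x (q m) - cdist H w Y x z) : ¬ InPetal H w Y x q m r z := by
  rintro ⟨i, hi, hr⟩
  have := cdist_triangle hw hc hx (hq.mem i hi) hz
  have := cdist_nonneg (H := H) (Y := Y) (x := q i) (y := z) hw
  linarith

/-- Two distances to `z` enter with coefficient 2, hence the factor 4. This is what turns a gap
between radii into a lower bound on walk lengths. -/
lemma InPetal.of_dist (hq : IsRay H w Y x q m) (hz : z ∈ Y) (hz' : z' ∈ Y)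
    (h : InPetal H w Y x q m r z) : InPetal H w Y x q m (r + 4 * cdist H w Y z z') z' := by
  obtain ⟨i, hi, hr⟩ := h
  refine ⟨i, hi, ?_⟩
  have := cdist_triangle hw hc (hq.mem i hi) hz hz'
  have := cdist_triangle hw hc hx hz' hz
  rw [cdist_comm (x := z') (y := z)] at this
  linarith

omit [Finite V] hc hx in
lemma ray_inPetal (hq : IsRay H w Y x q m) {j : ℕ} (hj : j ≤ m)
    (h : cdist H w Y x (q m) - cdist H w Y x (q j) ≤ r) : InPetal H w Y x q m r (q j) := by
  refine ⟨j, hj, ?_⟩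
  rw [cdist_self hw (hq.mem j hj)]
  linarith

lemma dist_end_le_of_inPetal (hq : IsRay H w Y x q m) (hz : z ∈ Y) {i : ℕ} (hi : i ≤ m)
    (h : cdist H w Y x (q m) + cdist H w Y x (q i) + 2 * cdist H w Y (q i) z
      - 2 * cdist H w Y x z ≤ r) : cdist H w Y x (q m) - cdist H w Y x (q i) ≤ r := by
  have := cdist_triangle hw hc hx (hq.mem i hi) hz
  linarith

/-- Shortest paths from the center to points outside the petal avoid the petal. -/
lemma exists_walk_compl_petal (hq : IsRay H w Y x q m) (hz : z ∈ Y)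
    (h : ¬ InPetal H w Y x q m r z) :
    ∃ p : H.Walk x z, (∀ a ∈ p.support, a ∈ Y ∧ ¬ InPetal H w Y x q m r a) ∧
      wlen w p = cdist H w Y x z := by
  obtain ⟨p, hp, hl⟩ := exists_geodesic hw hc hx hz
  refine ⟨p, fun a ha => ⟨hp a ha, ?_⟩, hl⟩
  rintro ⟨i, hi, hr⟩
  refine h ⟨i, hi, ?_⟩
  have := cdist_add_cdist hw hc hp hl ha
  have := cdist_triangle hw hc (hq.mem i hi) (hp a ha) hz
  linarith

/-- Shortest paths inside a cone. -/
lemma exists_walk_petal (hq : IsRay H w Y x q m) (hz : z ∈ Y) {i : ℕ} (hi : i ≤ m)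
    (h : cdist H w Y x (q m) + cdist H w Y x (q i) + 2 * cdist H w Y (q i) z
      - 2 * cdist H w Y x z ≤ r) :
    ∃ p : H.Walk (q i) z, Inside (petal H w Y x q m r) p ∧ wlen w p = cdist H w Y (q i) z := by
  obtain ⟨p, hp, hl⟩ := exists_geodesic hw hc (hq.mem i hi) hz
  refine ⟨p, fun a ha => mem_petal.2 ⟨hp a ha, i, hi, ?_⟩, hl⟩
  have := cdist_add_cdist hw hc hp hl ha
  have := cdist_triangle hw hc hx (hp a ha) hz
  linarith

section Complement

variable [DecidableEq V]

lemma isConn_compl_petal (hq : IsRay H w Y x q m) : IsConn H (Y \ petal H w Y x q m r) := by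
  refine IsConn.of_center (x := x) fun z hz => ?_
  simp only [Finset.mem_sdiff, mem_petal, not_and] at hz
  obtain ⟨p, hp, -⟩ := exists_walk_compl_petal hw hc hx hq hz.1 (hz.2 hz.1)
  refine ⟨p, fun a ha => ?_⟩
  simp only [Finset.mem_sdiff, mem_petal, not_and]
  exact ⟨(hp a ha).1, fun _ => (hp a ha).2⟩

/-- The complement contains a shortest path of `Y` from `x` to each of its points, so cutting off a
petal leaves distances from the center unchanged. -/
lemma cdist_compl_petal (hq : IsRay H w Y x q m) (hz : z ∈ Y \ petal H w Y x q m r) :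
    cdist H w (Y \ petal H w Y x q m r) x z = cdist H w Y x z := by
  have hz' := hz
  simp only [Finset.mem_sdiff, mem_petal, not_and] at hz'
  obtain ⟨p, hp, hl⟩ := exists_walk_compl_petal hw hc hx hq hz'.1 (hz'.2 hz'.1)
  have hpi : Inside (Y \ petal H w Y x q m r) p := fun a ha => by
    simp only [Finset.mem_sdiff, mem_petal, not_and]
    exact ⟨(hp a ha).1, fun _ => (hp a ha).2⟩
  refine le_antisymm ((cdist_le hw hpi).trans_eq hl) ?_
  exact cdist_anti hw Finset.sdiff_subset (isConn_compl_petal hw hc hx hq)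
    (hpi _ p.start_mem_support) hz

/-- A ray (possibly different from the one defining the petal) restricted to the complement of the
petal. -/
lemma isRay_compl_petal (hq : IsRay H w Y x q m) {p : ℕ → V} {n n' : ℕ}
    (hp : IsRay H w Y x p n) (hn : n' ≤ n) (h : ∀ i ≤ n', p i ∈ Y \ petal H w Y x q m r) :
    IsRay H w (Y \ petal H w Y x q m r) x p n' where
  zero := hp.zero
  mem := h
  adj i hi := hp.adj i (by omega)
  dist i hi := by
    rw [cdist_compl_petal hw hc hx hq (h i hi.le), cdist_compl_petal hw hc hx hq (h _ hi)]
    exact hp.dist i (by omega)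

end Complement

section Petal

variable {j : ℕ}

omit [Finite V] hw hc hx in
lemma cutoff_le (hcut : ∀ i < j, r < cdist H w Y x (q m) - cdist H w Y x (q i)) {i : ℕ}
    (hi : cdist H w Y x (q m) - cdist H w Y x (q i) ≤ r) : j ≤ i := by
  by_contra! h
  exact absurd hi (not_le.2 (hcut i h))

omit [Finite V] hc hx in
lemma exists_walk_ray_petal (hq : IsRay H w Y x q m) {i : ℕ}
    (hjr : cdist H w Y x (q m) - cdist H w Y x (q j) ≤ r) (hji : j ≤ i) (hi : i ≤ m) :
    ∃ p : H.Walk (q j) (q i), Inside (petal H w Y x q m r) p ∧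
      ∀ w' : Sym2 V → ℝ, wlen w' p = ∑ l ∈ Finset.Ico j i, w' s(q l, q (l + 1)) := by
  obtain ⟨p, hp, hl⟩ := hq.exists_walk hji hi
  refine ⟨p, fun a ha => ?_, hl⟩
  obtain ⟨l, h1, h2, rfl⟩ := hp a ha
  refine mem_petal.2 ⟨hq.mem l (by omega), ray_inPetal hw hq (by omega) ?_⟩
  have := hq.dist_mono hw h1 (by omega)
  linarith

/-- Each cone contains shortest paths from its apex. By the minimality of `j`, every apex that
contributes lies on the ray at or after `q j`, and that stretch of the ray is inside the petal. -/
lemma isConn_petal (hq : IsRay H w Y x q m)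
    (hjr : cdist H w Y x (q m) - cdist H w Y x (q j) ≤ r)
    (hcut : ∀ i < j, r < cdist H w Y x (q m) - cdist H w Y x (q i)) :
    IsConn H (petal H w Y x q m r) := by
  refine IsConn.of_center (x := q j) fun z hz => ?_
  obtain ⟨hzY, i, hi, hr⟩ := mem_petal.1 hz
  have hji := cutoff_le hcut (dist_end_le_of_inPetal hw hc hx hq hzY hi hr)
  obtain ⟨p, hp, -⟩ := exists_walk_ray_petal hw hq hjr hji hi
  obtain ⟨s, hs, -⟩ := exists_walk_petal hw hc hx hq hzY hi hr
  exact ⟨p.append s, hp.append hs⟩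

/-- Distances from the new center `q j` inside the petal, for smaller weights `w'`. -/
lemma cdist_petal_le (hq : IsRay H w Y x q m) {w' : Sym2 V → ℝ} (hw' : ∀ e, 0 ≤ w' e)
    (hww' : ∀ e, w' e ≤ w e) (hjr : cdist H w Y x (q m) - cdist H w Y x (q j) ≤ r)
    (hcut : ∀ i < j, r < cdist H w Y x (q m) - cdist H w Y x (q i))
    (hz : z ∈ petal H w Y x q m r) :
    ∃ i, j ≤ i ∧ i ≤ m ∧
      cdist H w Y x (q m) + cdist H w Y x (q i) + 2 * cdist H w Y (q i) z
        - 2 * cdist H w Y x z ≤ r ∧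
      cdist H w' (petal H w Y x q m r) (q j) z ≤
        ∑ l ∈ Finset.Ico j i, w' s(q l, q (l + 1)) + cdist H w Y (q i) z := by
  obtain ⟨hzY, i, hi, hr⟩ := mem_petal.1 hz
  have hji := cutoff_le hcut (dist_end_le_of_inPetal hw hc hx hq hzY hi hr)
  obtain ⟨p, hp, hpl⟩ := exists_walk_ray_petal hw hq hjr hji hi
  obtain ⟨s, hs, hsl⟩ := exists_walk_petal hw hc hx hq hzY hi hr
  refine ⟨i, hji, hi, hr, (cdist_le hw' (hp.append hs)).trans ?_⟩
  rw [wlen_append, hpl, ← hsl]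
  have := wlen_mono hww' s
  linarith

/-- The end of the ray is a ray from `q j` in the petal if the weights of its edges are
multiplied by `c` and no weight is multiplied by less. -/
lemma isRay_petal (hq : IsRay H w Y x q m) {w' : Sym2 V → ℝ} (hw' : ∀ e, 0 ≤ w' e) {c : ℝ}
    (hcw : ∀ e, c * w e ≤ w' e) (hc0 : 0 ≤ c)
    (hray : ∀ i, j ≤ i → i < m → w' s(q i, q (i + 1)) = c * w s(q i, q (i + 1)))
    (hj : j ≤ m) (hjr : cdist H w Y x (q m) - cdist H w Y x (q j) ≤ r)
    (hcut : ∀ i < j, r < cdist H w Y x (q m) - cdist H w Y x (q i)) :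
    IsRay H w' (petal H w Y x q m r) (q j) (fun l => q (j + l)) (m - j) ∧
      ∀ i, j ≤ i → i ≤ m → cdist H w' (petal H w Y x q m r) (q j) (q i) =
        c * (cdist H w Y x (q i) - cdist H w Y x (q j)) := by
  have hmem : ∀ i, j ≤ i → i ≤ m → q i ∈ petal H w Y x q m r := fun i hji hi => by
    refine mem_petal.2 ⟨hq.mem i hi, ray_inPetal hw hq hi ?_⟩
    have := hq.dist_mono hw hji hi
    linarith
  have hd : ∀ i, j ≤ i → i ≤ m → cdist H w' (petal H w Y x q m r) (q j) (q i) =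
        c * (cdist H w Y x (q i) - cdist H w Y x (q j)) := by
    intro i hji hi
    apply le_antisymm
    · obtain ⟨p, hp, hpl⟩ := exists_walk_ray_petal hw hq hjr hji hi
      refine (cdist_le hw' hp).trans_eq ?_
      rw [hpl, ← hq.sum_eq hji hi, Finset.mul_sum]
      refine Finset.sum_congr rfl fun l hl => ?_
      rw [Finset.mem_Ico] at hl
      exact hray l hl.1 (by omega)
    -- No detour is a shortcut: a walk inside the petal has `w'`-length at least `c` times its
    -- `w`-length, and the triangle inequality from `x` bounds the latter.
    · refine le_cdist (isConn_petal hw hc hx hq hjr hcut) (hmem j le_rfl hj) (hmem i hji hi)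
        fun p hp => ?_
      have h1 := wlen_mono hcw p
      rw [wlen_smul] at h1
      have h2 := cdist_le hw (hp.mono petal_subset)
      have h3 := cdist_triangle hw hc hx (hq.mem j hj) (hq.mem i hi)
      refine le_trans ?_ h1
      exact mul_le_mul_of_nonneg_left (by linarith) hc0
  refine ⟨⟨rfl, fun i hi => hmem _ (by omega) (by omega), fun i hi => hq.adj _ (by omega),
    fun i hi => ?_⟩, hd⟩
  change cdist _ _ _ _ (q (j + i + 1)) = _
  rw [hd _ (by omega) (by omega), hd _ (by omega) (by omega), hq.dist _ (by omega)]
  change _ = _ + w' s(q (j + i), q (j + i + 1))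
  rw [hray _ (by omega) (by omega)]
  ring

end Petal

end

/-! ### Tree covers and joining two of them by an edge. -/

section

/-- Acyclicity comes from counting: the joined graph is connected, and it has at most one edge more
than the two trees together. -/
lemma isTree_sum_sup_edge {W₁ W₂ : Type*} [Finite W₁] [Finite W₂] {T₁ : SimpleGraph W₁}
    {T₂ : SimpleGraph W₂} (h₁ : T₁.IsTree) (h₂ : T₂.IsTree) (a : W₁) (b : W₂) :
    ((T₁ ⊕g T₂) ⊔ edge (Sum.inl a) (Sum.inr b)).IsTree := by
  have hconn : ((T₁ ⊕g T₂) ⊔ edge (Sum.inl a) (Sum.inr b)).Connected :=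
    h₁.connected.sum_sup_edge h₂.connected
  refine isTree_iff_connected_and_card.2 ⟨hconn, le_antisymm ?_ hconn.card_vert_le_card_edgeSet_add_one⟩
  have e₁ := (isTree_iff_connected_and_card.1 h₁).2
  have e₂ := (isTree_iff_connected_and_card.1 h₂).2
  have hsub : ((T₁ ⊕g T₂) ⊔ edge (Sum.inl a) (Sum.inr b)).edgeSet ⊆
      (Sym2.map Sum.inl '' T₁.edgeSet ∪ Sym2.map Sum.inr '' T₂.edgeSet) ∪
        {s(Sum.inl a, Sum.inr b)} := by
    intro e he
    induction e with | _ u v =>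
    rw [mem_edgeSet, sup_adj] at he
    rcases he with he | he
    · left
      rcases u with u | u <;> rcases v with v | v
      · exact Or.inl ⟨s(u, v), by simpa using he, rfl⟩
      · simp at he
      · simp at he
      · exact Or.inr ⟨s(u, v), by simpa using he, rfl⟩
    · right
      rw [edge_adj] at he
      rcases he.1 with ⟨rfl, rfl⟩ | ⟨rfl, rfl⟩
      · rfl
      · exact Sym2.eq_swap
  have h := Set.ncard_le_ncard hsub (Set.toFinite _)
  have h' := Set.ncard_union_le (Sym2.map Sum.inl '' T₁.edgeSet ∪ Sym2.map Sum.inr '' T₂.edgeSet)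
        {s(Sum.inl a, Sum.inr b)}
  have h'' := Set.ncard_union_le (Sym2.map (Sum.inl : W₁ → W₁ ⊕ W₂) '' T₁.edgeSet)
    (Sym2.map Sum.inr '' T₂.edgeSet)
  have i₁ := Set.ncard_image_le (f := Sym2.map (Sum.inl : W₁ → W₁ ⊕ W₂)) (Set.toFinite T₁.edgeSet)
  have i₂ := Set.ncard_image_le (f := Sym2.map (Sum.inr : W₂ → W₁ ⊕ W₂)) (Set.toFinite T₂.edgeSet)
  rw [Set.ncard_singleton] at h'
  rw [Nat.card_sum]
  simp only [Nat.card_coe_set_eq] at *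
  omega

variable {V : Type u} {H : SimpleGraph V} {w : Sym2 V → ℝ} {x y z : V} {Y Y₁ Y₂ : Finset V}

/-- A tree whose vertices are copies of the vertices in `Y` and whose edges are copies of edges
of `H`, with a root and a chosen copy `χ v` of every `v`. -/
structure TreeCover (H : SimpleGraph V) (Y : Finset V) where
  W : Type u
  fintype : Fintype W
  T : SimpleGraph W
  isTree : T.IsTree
  π : T →g H
  range : ∀ v, v ∈ Y ↔ ∃ a, π a = v
  root : W
  χ : V → W
  π_χ : ∀ v ∈ Y, π (χ v) = v

attribute [instance] TreeCover.fintype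

namespace TreeCover

/-- The tree has a walk from `a` to `b` of length at most `l`. -/
def Within (c : TreeCover H Y) (w : Sym2 V → ℝ) (a b : c.W) (l : ℝ) : Prop :=
  ∃ p : c.T.Walk a b, wlen (fun e => w (Sym2.map c.π e)) p ≤ l

variable {c : TreeCover H Y}

lemma Within.mono {a b : c.W} {l l' : ℝ} (h : c.Within w a b l) (hl : l ≤ l') :
    c.Within w a b l' := by
  obtain ⟨p, hp⟩ := h
  exact ⟨p, hp.trans hl⟩

lemma Within.symm {a b : c.W} {l : ℝ} (h : c.Within w a b l) : c.Within w b a l := by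
  obtain ⟨p, hp⟩ := h
  exact ⟨p.reverse, by rwa [wlen_reverse]⟩

lemma Within.trans {a b d : c.W} {l l' : ℝ} (h : c.Within w a b l) (h' : c.Within w b d l') :
    c.Within w a d (l + l') := by
  obtain ⟨p, hp⟩ := h
  obtain ⟨p', hp'⟩ := h'
  exact ⟨p.append p', by rw [wlen_append]; linarith⟩

lemma π_mem (c : TreeCover H Y) (a : c.W) : c.π a ∈ Y := (c.range _).2 ⟨a, rfl⟩

open Classical in
/-- Join two trees by an edge; the copy `χ v` is taken from the second one if `S v`. -/
noncomputable def join (c₁ : TreeCover H Y₁) (c₂ : TreeCover H Y₂) (a : c₁.W) (b : c₂.W)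
    (hab : H.Adj (c₁.π a) (c₂.π b)) (hY : ∀ v, v ∈ Y ↔ v ∈ Y₁ ∨ v ∈ Y₂) (S : V → Prop)
    (hS₁ : ∀ v ∈ Y, ¬ S v → v ∈ Y₁) (hS₂ : ∀ v ∈ Y, S v → v ∈ Y₂) : TreeCover H Y where
  W := c₁.W ⊕ c₂.W
  fintype := inferInstance
  T := (c₁.T ⊕g c₂.T) ⊔ edge (Sum.inl a) (Sum.inr b)
  isTree := isTree_sum_sup_edge c₁.isTree c₂.isTree a b
  π := ⟨Sum.elim c₁.π c₂.π, by
    intro u v h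
    rw [sup_adj, edge_adj] at h
    rcases h with h | ⟨⟨rfl, rfl⟩ | ⟨rfl, rfl⟩, -⟩
    · rcases u with u | u <;> rcases v with v | v
      · exact c₁.π.map_adj (by simpa using h)
      · simp at h
      · simp at h
      · exact c₂.π.map_adj (by simpa using h)
    · exact hab
    · exact hab.symm⟩
  range v := by
    rw [hY, c₁.range, c₂.range]
    constructor
    · rintro (⟨a, h⟩ | ⟨a, h⟩)
      exacts [⟨Sum.inl a, h⟩, ⟨Sum.inr a, h⟩]
    · rintro ⟨a | a, h⟩
      exacts [Or.inl ⟨a, h⟩, Or.inr ⟨a, h⟩]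
  root := Sum.inl c₁.root
  χ v := if S v then Sum.inr (c₂.χ v) else Sum.inl (c₁.χ v)
  π_χ v hv := by
    by_cases h : S v
    · simpa [h] using c₂.π_χ v (hS₂ v hv h)
    · simpa [h] using c₁.π_χ v (hS₁ v hv h)

section Join

variable {c₁ : TreeCover H Y₁} {c₂ : TreeCover H Y₂} {a : c₁.W} {b : c₂.W}
    {hab : H.Adj (c₁.π a) (c₂.π b)} {hY : ∀ v, v ∈ Y ↔ v ∈ Y₁ ∨ v ∈ Y₂} {S : V → Prop}
    {hS₁ : ∀ v ∈ Y, ¬ S v → v ∈ Y₁} {hS₂ : ∀ v ∈ Y, S v → v ∈ Y₂}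

lemma Within.inl {u v : c₁.W} {l : ℝ} (h : c₁.Within w u v l) :
    (join c₁ c₂ a b hab hY S hS₁ hS₂).Within w (Sum.inl u) (Sum.inl v) l := by
  obtain ⟨p, hp⟩ := h
  let f : c₁.T →g (join c₁ c₂ a b hab hY S hS₁ hS₂).T :=
    ⟨Sum.inl, fun h => Or.inl (sum_adj_inl.2 h)⟩
  refine ⟨p.map f, ?_⟩
  rw [wlen_map]
  refine le_of_eq_of_le ?_ hp
  congr 1
  ext e
  induction e with | _ u v => rfl

lemma Within.inr {u v : c₂.W} {l : ℝ} (h : c₂.Within w u v l) :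
    (join c₁ c₂ a b hab hY S hS₁ hS₂).Within w (Sum.inr u) (Sum.inr v) l := by
  obtain ⟨p, hp⟩ := h
  let f : c₂.T →g (join c₁ c₂ a b hab hY S hS₁ hS₂).T :=
    ⟨Sum.inr, fun h => Or.inl (sum_adj_inr.2 h)⟩
  refine ⟨p.map f, ?_⟩
  rw [wlen_map]
  refine le_of_eq_of_le ?_ hp
  congr 1
  ext e
  induction e with | _ u v => rfl

lemma within_portal : (join c₁ c₂ a b hab hY S hS₁ hS₂).Within w (Sum.inl a) (Sum.inr b)
    (w s(c₁.π a, c₂.π b)) := by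
  have h : (join c₁ c₂ a b hab hY S hS₁ hS₂).T.Adj (Sum.inl a) (Sum.inr b) :=
    Or.inr (by simp [edge_adj])
  exact ⟨Walk.cons h Walk.nil, (((wlen_cons h Walk.nil).trans
    (congrArg (fun t => _ + t) wlen_nil)).trans (add_zero _)).le⟩

end Join

/-- The number of copies, weighted by `ν`. -/
noncomputable def size (c : TreeCover H Y) (ν : V → ℝ) : ℝ := ∑ a : c.W, ν (c.π a)

/-- Every `u` has a copy whose distance from `χ v` is at most `t` times the length of any walk
inside `Y` from `v` to `u`. -/
def HasStretch (c : TreeCover H Y) (w : Sym2 V → ℝ) (t : ℝ) : Prop :=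
  ∀ v u, ∀ p : H.Walk v u, Inside Y p → ∃ a, c.π a = u ∧ c.Within w (c.χ v) a (t * wlen w p)

lemma size_join {ν : V → ℝ} (c₁ : TreeCover H Y₁) (c₂ : TreeCover H Y₂) (a : c₁.W) (b : c₂.W)
    (hab : H.Adj (c₁.π a) (c₂.π b)) (hY : ∀ v, v ∈ Y ↔ v ∈ Y₁ ∨ v ∈ Y₂) (S : V → Prop)
    (hS₁ : ∀ v ∈ Y, ¬ S v → v ∈ Y₁) (hS₂ : ∀ v ∈ Y, S v → v ∈ Y₂) :
    (join c₁ c₂ a b hab hY S hS₁ hS₂).size ν = c₁.size ν + c₂.size ν :=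
  Fintype.sum_sum_type fun z : c₁.W ⊕ c₂.W => ν (Sum.elim c₁.π c₂.π z)

/-- Walks that leave the part containing their chief have length at least `δ`; they are
stretched by at most `2 * B / δ` if the tree has radius at most `B`. -/
lemma hasStretch_join (c₁ : TreeCover H Y₁) (c₂ : TreeCover H Y₂) (a : c₁.W) (b : c₂.W)
    (hab : H.Adj (c₁.π a) (c₂.π b)) (hY : ∀ v, v ∈ Y ↔ v ∈ Y₁ ∨ v ∈ Y₂) (S : V → Prop)
    (hS₁ : ∀ v ∈ Y, ¬ S v → v ∈ Y₁) (hS₂ : ∀ v ∈ Y, S v → v ∈ Y₂) {t B δ : ℝ} (ht : 0 ≤ t)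
    (hB : ∀ z, (join c₁ c₂ a b hab hY S hS₁ hS₂).Within w
      (join c₁ c₂ a b hab hY S hS₁ hS₂).root z B)
    (htB : 2 * B ≤ t * δ) (h₁ : c₁.HasStretch w t) (h₂ : c₂.HasStretch w t)
    (hδ₁ : ∀ v u, ∀ p : H.Walk v u, Inside Y p → ¬ S v → ∀ z ∈ p.support, z ∉ Y₁ → δ ≤ wlen w p)
    (hδ₂ : ∀ v u, ∀ p : H.Walk v u, Inside Y p → S v → ∀ z ∈ p.support, z ∉ Y₂ → δ ≤ wlen w p) :
    (join c₁ c₂ a b hab hY S hS₁ hS₂).HasStretch w t := by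
  intro v u p hp
  have far (h : δ ≤ wlen w p) : ∃ z, (join c₁ c₂ a b hab hY S hS₁ hS₂).π z = u ∧
      (join c₁ c₂ a b hab hY S hS₁ hS₂).Within w ((join c₁ c₂ a b hab hY S hS₁ hS₂).χ v) z
        (t * wlen w p) := by
    obtain ⟨z, hz⟩ := ((join c₁ c₂ a b hab hY S hS₁ hS₂).range u).1 (hp u p.end_mem_support)
    refine ⟨z, hz, ((hB _).symm.trans (hB z)).mono ?_⟩
    have := mul_le_mul_of_nonneg_left h ht
    linarith
  by_cases hv : S v
  · by_cases hin : Inside Y₂ p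
    · obtain ⟨z, hz, hzw⟩ := h₂ v u p hin
      refine ⟨Sum.inr z, hz, ?_⟩
      have : (join c₁ c₂ a b hab hY S hS₁ hS₂).χ v = Sum.inr (c₂.χ v) := if_pos hv
      rw [this]
      exact hzw.inr
    · simp only [Inside, not_forall] at hin
      obtain ⟨z, hz, hzY⟩ := hin
      exact far (hδ₂ v u p hp hv z hz hzY)
  · by_cases hin : Inside Y₁ p
    · obtain ⟨z, hz, hzw⟩ := h₁ v u p hin
      refine ⟨Sum.inl z, hz, ?_⟩
      have : (join c₁ c₂ a b hab hY S hS₁ hS₂).χ v = Sum.inl (c₁.χ v) := if_neg hv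
      rw [this]
      exact hzw.inl
    · simp only [Inside, not_forall] at hin
      obtain ⟨z, hz, hzY⟩ := hin
      exact far (hδ₁ v u p hp hv z hz hzY)

end TreeCover

end

/-! ### Region growing. -/

section

lemma pow_pow_le_one_add_inv_pow {k : ℕ} (hk : 1 ≤ k) (l : ℕ) :
    (2 : ℝ) ^ l ≤ (1 + 1 / (k : ℝ)) ^ (k * l) := by
  have hk' : (0 : ℝ) < k := by exact_mod_cast hk
  rw [pow_mul]
  refine pow_le_pow_left₀ (by norm_num) ?_ l
  have := one_add_mul_le_pow (a := 1 / (k : ℝ)) (by have : 0 < 1 / (k : ℝ) := by positivity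
                                                    linarith) k
  rw [mul_one_div_cancel hk'.ne'] at this
  linarith

/-- If `b ^ (1 + κ) > b' * N ^ κ`, then `log (N / b)` is at most `log (N / b') / (1 + κ)`. -/
lemma logb_gap {b b' N κ : ℝ} (hb : 0 < b) (hb' : 0 < b') (hN : 0 < N)
    (h : b' * N ^ κ < b ^ (1 + κ)) :
    (1 + κ) * (Real.logb 2 N - Real.logb 2 b) < Real.logb 2 N - Real.logb 2 b' := by
  have h1 := Real.logb_lt_logb (b := 2) (by norm_num) (by positivity) h
  rw [Real.logb_mul hb'.ne' (Real.rpow_pos_of_pos hN _).ne', Real.logb_rpow_eq_mul_logb_of_pos hN,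
    Real.logb_rpow_eq_mul_logb_of_pos hb] at h1
  linarith

/-- Region growing: one of `2 * k * l` consecutive radii has a sparse boundary. -/
lemma exists_sparse_cut {k : ℕ} (hk : 1 ≤ k) {l : ℕ} (hl : 1 ≤ l) {N : ℝ} (hN : N ≤ 2 ^ 2 ^ l)
    (a : ℕ → ℝ) (ha : ∀ i ≤ 2 * (k * l), 1 ≤ a i) (ha' : ∀ i ≤ 2 * (k * l), a i ≤ N - 1) :
    ∃ i < 2 * (k * l), (a (i + 1)) ^ (1 + 1 / (k : ℝ)) + (N - a i) ^ (1 + 1 / (k : ℝ)) ≤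
      N ^ (1 + 1 / (k : ℝ)) := by
  by_contra! hcon
  have hkl : 1 ≤ k * l := Nat.mul_pos hk hl
  have hk' : (0 : ℝ) < k := by exact_mod_cast hk
  set κ : ℝ := 1 / (k : ℝ) with hκ
  have hκ0 : 0 < κ := by positivity
  have hN0 : 0 < N := by linarith [ha 0 (by omega), ha' 0 (by omega)]
  have hN1 : N ^ (1 + κ) = N * N ^ κ := by rw [Real.rpow_add hN0, Real.rpow_one]
  have split : ∀ b : ℝ, 0 < b → b ≤ N → b ^ (1 + κ) ≤ b * N ^ κ := fun b hb hbN => by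
    rw [Real.rpow_add hb, Real.rpow_one]
    exact mul_le_mul_of_nonneg_left (Real.rpow_le_rpow hb.le hbN hκ0.le) hb.le
  -- If every cut fails, estimating either one of the two terms linearly leaves a growth inequality
  -- for the other: here for the inner mass `a`, in `step2` for the outer mass `N - a`.
  have step1 : ∀ i < 2 * (k * l), a i * N ^ κ < a (i + 1) ^ (1 + κ) := fun i hi => by
    have h := hcon i hi
    have := split (N - a i) (by linarith [ha' i (by omega)]) (by linarith [ha i (by omega)])
    rw [hN1] at h
    linarith
  have step2 : ∀ i < 2 * (k * l), (N - a (i + 1)) * N ^ κ < (N - a i) ^ (1 + κ) := fun i hi => by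
    have h := hcon i hi
    have := split (a (i + 1)) (by linarith [ha (i + 1) (by omega)])
      (by linarith [ha' (i + 1) (by omega)])
    rw [hN1] at h
    linarith
  set L := Real.logb 2 N with hL
  have hLl : L ≤ 2 ^ l := by
    have := Real.logb_le_logb_of_le (b := 2) (by norm_num) hN0 hN
    rw [← Real.rpow_natCast, Real.logb_rpow (by norm_num) (by norm_num)] at this
    simpa using this
  have hpow := pow_pow_le_one_add_inv_pow hk l
  -- The first `k * l` steps shrink `log (N / a)` geometrically from at most `L ≤ 2 ^ l` to at most
  -- 1, so that the inner mass reaches `N / 2`.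
  have gap1 : ∀ i ≤ k * l, (1 + κ) ^ i * (L - Real.logb 2 (a i)) ≤ L := by
    intro i
    induction i with
    | zero =>
      intro _
      have := Real.logb_nonneg (b := 2) (by norm_num) (ha 0 (by omega))
      simp only [pow_zero, one_mul]
      linarith
    | succ i ih =>
      intro hi
      refine le_trans ?_ (ih (by omega))
      rw [pow_succ, mul_assoc]
      refine mul_le_mul_of_nonneg_left ?_ (by positivity)
      exact (logb_gap (by linarith [ha (i + 1) (by omega)]) (by linarith [ha i (by omega)]) hN0
        (step1 i (by omega))).le
  have half : N / 2 ≤ a (k * l) := by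
    have h1 := gap1 (k * l) le_rfl
    have h2 : L - Real.logb 2 (a (k * l)) ≤ 1 := by
      by_contra! h
      have : (1 + κ) ^ (k * l) * 1 < (1 + κ) ^ (k * l) * (L - Real.logb 2 (a (k * l))) :=
        mul_lt_mul_of_pos_left h (by positivity)
      linarith
    have h3 : Real.logb 2 (N / 2) ≤ Real.logb 2 (a (k * l)) := by
      rw [Real.logb_div hN0.ne' (by norm_num), Real.logb_self_eq_one (by norm_num)]
      linarith
    exact (Real.logb_le_logb (by norm_num) (by positivity)
      (by linarith [ha (k * l) (by omega)])).1 h3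
  -- From there on, `log (N / (N - a))` starts at no less than 1 and grows geometrically. After `k *
  -- l` more steps it would exceed `L`, although `N - a ≥ 1`.
  have gap2 : ∀ i ≤ k * l, (1 + κ) ^ i ≤ L - Real.logb 2 (N - a (k * l + i)) := by
    intro i
    induction i with
    | zero =>
      intro _
      have h1 : Real.logb 2 (N - a (k * l)) ≤ Real.logb 2 (N / 2) :=
        Real.logb_le_logb_of_le (by norm_num) (by linarith [ha' (k * l) (by omega)]) (by linarith)
      rw [Real.logb_div hN0.ne' (by norm_num), Real.logb_self_eq_one (by norm_num)] at h1
      simp only [pow_zero, add_zero]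
      linarith
    | succ i ih =>
      intro hi
      have := (logb_gap (by linarith [ha' (k * l + i) (by omega)])
        (by linarith [ha' (k * l + i + 1) (by omega)]) hN0 (step2 (k * l + i) (by omega))).le
      refine le_trans ?_ this
      rw [pow_succ, mul_comm]
      exact mul_le_mul_of_nonneg_left (ih (by omega)) (by positivity)
  obtain ⟨j, hj⟩ : ∃ j, k * l = j + 1 := ⟨k * l - 1, by omega⟩
  have h1 := gap2 j (by omega)
  -- The last step is taken separately to retain the strict inequality needed for the contradiction.
  have h2 := logb_gap (by linarith [ha' (k * l + j) (by omega)])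
        (by linarith [ha' (k * l + j + 1) (by omega)]) hN0 (step2 (k * l + j) (by omega))
  have h3 : 0 ≤ Real.logb 2 (N - a (k * l + j + 1)) :=
    Real.logb_nonneg (by norm_num) (by linarith [ha' (k * l + j + 1) (by omega)])
  have h4 := mul_le_mul_of_nonneg_left h1 (by positivity : (0 : ℝ) ≤ 1 + κ)
  have h5 : (1 + κ) ^ (k * l) = (1 + κ) * (1 + κ) ^ j := by rw [hj, pow_succ, mul_comm]
  linarith

end

/-! ### Halved weights, the base case, and a single decomposition step. -/

section

variable {V : Type u} {H : SimpleGraph V} {w w' : Sym2 V → ℝ} {x : V} {Y : Finset V}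
  {q : ℕ → V} {m : ℕ}

/-- Inside `Y`, the weights `w'` arise from `w` by at most halving the weights of edges of the
protected ray `q 0, …, q m`. -/
structure IsHalving (H : SimpleGraph V) (w w' : Sym2 V → ℝ) (Y : Finset V) (q : ℕ → V) (m : ℕ) :
    Prop where
  nonneg : ∀ e, 0 ≤ w' e
  le : ∀ e, w' e ≤ w e
  edge : ∀ a ∈ Y, ∀ b ∈ Y, H.Adj a b → w' s(a, b) = w s(a, b) ∨
    (w s(a, b) ≤ 2 * w' s(a, b) ∧ ∃ i < m, s(a, b) = s(q i, q (i + 1)))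

lemma IsHalving.le_two_mul (h : IsHalving H w w' Y q m) {a b : V} (ha : a ∈ Y) (hb : b ∈ Y)
    (hab : H.Adj a b) : w s(a, b) ≤ 2 * w' s(a, b) := by
  rcases h.edge a ha b hb hab with h' | h'
  · have := h.nonneg s(a, b)
    linarith
  · exact h'.1

/-- The tree has root `x`, its radius is controlled by the distances in `Y`, and the protected ray
is kept up to the halving. -/
structure TreeCover.Spans (c : TreeCover H Y) (w w' : Sym2 V → ℝ) (x : V) (q : ℕ → V) (m : ℕ) :
    Prop where
  root : c.π c.root = x
  dist : ∀ z, c.Within w c.root z (4 * cdist H w' Y x (c.π z))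
  ray : ∀ i ≤ m, ∃ z, c.π z = q i ∧ c.Within w c.root z (2 * cdist H w' Y x (q i))

/-- Weights are at most halved, so edges of `w'`-weight zero have `w`-weight zero. These edges
connect `Y`, and any spanning tree of them works with a single copy of each vertex. -/
lemma exists_cover_of_radius_eq_zero [Finite V] (hw : ∀ e, 0 ≤ w e) (hc : IsConn H Y) (hx : x ∈ Y)
    (hh : IsHalving H w w' Y q m) (hq : IsRay H w' Y x q m)
    (hR : ∀ z ∈ Y, cdist H w' Y x z = 0) :
    ∃ c : TreeCover H Y, c.Spans w w' x q m ∧ (∀ ν, c.size ν = ∑ v ∈ Y, ν v) ∧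
      ∀ t, 0 ≤ t → c.HasStretch w t := by
  classical
  let Z : SimpleGraph Y :=
    { Adj := fun a b => H.Adj a b ∧ w s((a : V), (b : V)) = 0
      symm := ⟨fun a b h => ⟨h.1.symm, by rw [Sym2.eq_swap]; exact h.2⟩⟩
      loopless := ⟨fun a h => H.loopless.irrefl _ h.1⟩ }
  have hreach : ∀ (a b : V) (p : H.Walk a b) (ha : a ∈ Y) (hb : b ∈ Y), Inside Y p →
      wlen w' p = 0 → Z.Reachable ⟨a, ha⟩ ⟨b, hb⟩ := by
    intro a b p
    induction p with
    | nil => intro _ _ _ _; exact Reachable.refl _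
    | @cons a b d h p ih =>
      intro ha hd hp hl
      rw [wlen_cons] at hl
      have hp' : Inside Y p := fun z hz => hp z (by simp [hz])
      have hb : b ∈ Y := hp' _ p.start_mem_support
      have h1 := hh.nonneg s(a, b)
      have h2 := wlen_nonneg hh.nonneg p
      have h3 := hh.le_two_mul ha hb h
      have hadj : Z.Adj ⟨a, ha⟩ ⟨b, hb⟩ := ⟨h, le_antisymm (by linarith) (hw _)⟩
      exact hadj.reachable.trans (ih hb hd hp' (by linarith))
  have hconn : Z.Connected := by
    refine (connected_iff_exists_forall_reachable _).2 ⟨⟨x, hx⟩, fun ⟨z, hz⟩ => ?_⟩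
    obtain ⟨p, hp, hl⟩ := exists_geodesic hh.nonneg hc hx hz
    exact hreach x z p hx hz hp (hl.trans (hR z hz))
  obtain ⟨T, hT, htree⟩ := hconn.exists_isTree_le
  let c : TreeCover H Y :=
    { W := Y
      fintype := inferInstance
      T := T
      isTree := htree
      π := ⟨Subtype.val, fun h => (hT h).1⟩
      range := fun v => ⟨fun hv => ⟨⟨v, hv⟩, rfl⟩, by rintro ⟨a, rfl⟩; exact a.2⟩
      root := ⟨x, hx⟩
      χ := fun v => if hv : v ∈ Y then ⟨v, hv⟩ else ⟨x, hx⟩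
      π_χ := fun v hv => by simp [hv] }
  have hwithin : ∀ a b : c.W, ∀ t, 0 ≤ t → c.Within w a b t := by
    intro a b t ht
    obtain ⟨p⟩ := htree.connected.preconnected a b
    refine ⟨p, le_of_eq_of_le (wlen_eq_zero p fun e he => ?_) ht⟩
    induction e with | _ a b => exact (hT (p.adj_of_mem_edges he)).2
  refine ⟨c, ⟨rfl, fun z => hwithin _ _ _ ?_, fun i hi => ⟨⟨q i, hq.mem i hi⟩, rfl,
    hwithin _ _ _ ?_⟩⟩, fun ν => Finset.sum_coe_sort Y ν, fun t ht v u p hp =>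
    ⟨⟨u, hp u p.end_mem_support⟩, rfl, hwithin _ _ _ (mul_nonneg ht (wlen_nonneg hw p))⟩⟩
  · have := cdist_nonneg (H := H) (Y := Y) (x := x) (y := c.π z) hh.nonneg
    linarith
  · have := cdist_nonneg (H := H) (Y := Y) (x := x) (y := q i) hh.nonneg
    linarith

/-- The candidates are multiples of `D / (4 * k * l)` up to `D / 2`. Every such petal contains `q m`
and misses `x`; as `ν ≥ 1`, both sides have mass at least 1, as region growing requires. -/
lemma exists_petal_radii [Finite V] [DecidableEq V] (hw : ∀ e, 0 ≤ w e) (hc : IsConn H Y)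
    (hx : x ∈ Y)
    (hq : IsRay H w Y x q m) (hD : 0 < cdist H w Y x (q m)) {ν : V → ℝ} (hν : ∀ v, 1 ≤ ν v)
    {k l : ℕ} (hk : 1 ≤ k) (hl : 1 ≤ l) (hN : ∑ v ∈ Y, ν v ≤ 2 ^ 2 ^ l) :
    ∃ r r', 0 ≤ r ∧ r' = r + cdist H w Y x (q m) / (4 * (k * l)) ∧ r < r' ∧
      r' ≤ cdist H w Y x (q m) / 2 ∧
      (∑ v ∈ petal H w Y x q m r', ν v) ^ (1 + 1 / (k : ℝ)) +
        (∑ v ∈ Y \ petal H w Y x q m r, ν v) ^ (1 + 1 / (k : ℝ)) ≤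
        (∑ v ∈ Y, ν v) ^ (1 + 1 / (k : ℝ)) := by
  set D := cdist H w Y x (q m) with hDdef
  have hk' : (0 : ℝ) < k := by exact_mod_cast hk
  have hl' : (0 : ℝ) < l := by exact_mod_cast hl
  set ρ := D / (4 * (k * l)) with hρ
  have hρ0 : 0 < ρ := by positivity
  have hρM : 2 * (k * l) * ρ = D / 2 := by
    rw [hρ]
    field_simp
    norm_num
  have hle : ∀ i : ℕ, i ≤ 2 * (k * l) → i * ρ ≤ D / 2 := fun i hi => by
    rw [← hρM]
    have : (i : ℝ) ≤ 2 * (k * l) := by exact_mod_cast hi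
    exact mul_le_mul_of_nonneg_right this hρ0.le
  have hdiff : ∀ r, ∑ v ∈ Y \ petal H w Y x q m r, ν v =
      ∑ v ∈ Y, ν v - ∑ v ∈ petal H w Y x q m r, ν v := fun r => by
    rw [← Finset.sum_sdiff (petal_subset (H := H) (w := w) (Y := Y) (x := x) (q := q) (m := m)
      (r := r))]
    ring
  have hsingle : ∀ (s : Finset V) v, v ∈ s → 1 ≤ ∑ v ∈ s, ν v := fun s v hv =>
    (hν v).trans (Finset.single_le_sum (f := ν) (fun a _ => zero_le_one.trans (hν a)) hv)
  obtain ⟨i, hi, hcut⟩ := exists_sparse_cut hk hl hN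
    (fun i => ∑ v ∈ petal H w Y x q m (i * ρ), ν v)
    (fun i _ => hsingle _ (q m) (mem_petal.2 ⟨hq.mem m le_rfl, ray_inPetal hw hq le_rfl (by
      rw [sub_self]
      positivity)⟩))
    (fun i hi => by
      have h := hsingle (Y \ petal H w Y x q m (i * ρ)) x (Finset.mem_sdiff.2 ⟨hx, fun h =>
        not_inPetal hw hc hx hq hx (by
          rw [cdist_self hw hx]
          have := hle i hi
          linarith) (mem_petal.1 h).2⟩)
      rw [hdiff] at h
      linarith)
  refine ⟨i * ρ, (i + 1 : ℕ) * ρ, by positivity, by push_cast; ring, ?_, hle _ hi, ?_⟩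
  · push_cast
    linarith
  · rw [hdiff]
    exact hcut

/-- Joining covers of the petal and of the complement of a smaller petal. -/
lemma exists_join [Finite V] [DecidableEq V] (hw' : ∀ e, 0 ≤ w' e) (hww' : ∀ e, w' e ≤ w e)
    (hc : IsConn H Y) (hx : x ∈ Y) (hq : IsRay H w' Y x q m)
    (hR : ∀ z ∈ Y, cdist H w' Y x z ≤ 2 * cdist H w' Y x (q m))
    {k l : ℕ} (hk : 1 ≤ k) (hl : 1 ≤ l) {r r' : ℝ}
    (hrr' : r' = r + cdist H w' Y x (q m) / (4 * (k * l))) (hlt : r < r')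
    {j : ℕ} (hj : j < m)
    (c₁ : TreeCover H (Y \ petal H w' Y x q m r)) (c₂ : TreeCover H (petal H w' Y x q m r'))
    (hroot₁ : c₁.π c₁.root = x)
    (hdist₁ : ∀ z, c₁.Within w c₁.root z
      (4 * cdist H w' (Y \ petal H w' Y x q m r) x (c₁.π z)))
    (hroot₂ : c₂.π c₂.root = q (j + 1)) {w'' : Sym2 V → ℝ}
    (hdist₂ : ∀ z, c₂.Within w c₂.root z
      (4 * cdist H w'' (petal H w' Y x q m r') (q (j + 1)) (c₂.π z)))
    (hst₁ : c₁.HasStretch w (512 * (k * l))) (hst₂ : c₂.HasStretch w (512 * (k * l)))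
    {a : c₁.W} (ha : c₁.π a = q j) {β : ℝ} (haβ : c₁.Within w c₁.root a β)
    (hfar : ∀ z ∈ petal H w' Y x q m r', β + w s(q j, q (j + 1)) +
      4 * cdist H w'' (petal H w' Y x q m r') (q (j + 1)) z ≤ 4 * cdist H w' Y x z) :
    ∃ c : TreeCover H Y, c.π c.root = x ∧
      (∀ z, c.Within w c.root z (4 * cdist H w' Y x (c.π z))) ∧
      (∀ ν, c.size ν = c₁.size ν + c₂.size ν) ∧ c.HasStretch w (512 * (k * l)) ∧
      (∀ z b, c₁.Within w c₁.root z b → ∃ z', c.π z' = c₁.π z ∧ c.Within w c.root z' b) ∧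
      ∀ z b, c₂.Within w c₂.root z b → ∃ z', c.π z' = c₂.π z ∧
        c.Within w c.root z' (β + w s(q j, q (j + 1)) + b) := by
  classical
  have hk' : (0 : ℝ) < k := by exact_mod_cast hk
  have hl' : (0 : ℝ) < l := by exact_mod_cast hl
  set D := cdist H w' Y x (q m) with hDdef
  have hab : H.Adj (c₁.π a) (c₂.π c₂.root) := by
    rw [ha, hroot₂]
    exact hq.adj j hj
  have hY : ∀ v, v ∈ Y ↔ v ∈ Y \ petal H w' Y x q m r ∨ v ∈ petal H w' Y x q m r' := by
    intro v
    simp only [Finset.mem_sdiff, mem_petal, not_and]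
    refine ⟨fun hv => ?_, ?_⟩
    · by_cases h : InPetal H w' Y x q m r v
      · exact Or.inr ⟨hv, h.mono hlt.le⟩
      · exact Or.inl ⟨hv, fun _ => h⟩
    · rintro (h | h)
      exacts [h.1, h.1]
  -- The middle radius leaves a buffer of `(r' - r) / 2` between the chiefs of either part and the
  -- boundary of that part.
  let S : V → Prop := InPetal H w' Y x q m ((r + r') / 2)
  have hS₁ : ∀ v ∈ Y, ¬ S v → v ∈ Y \ petal H w' Y x q m r := fun v hv hS =>
    Finset.mem_sdiff.2 ⟨hv, fun h => hS ((mem_petal.1 h).2.mono (by linarith))⟩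
  have hS₂ : ∀ v ∈ Y, S v → v ∈ petal H w' Y x q m r' := fun v hv hS =>
    mem_petal.2 ⟨hv, InPetal.mono (by linarith) hS⟩
  let c := c₁.join c₂ a c₂.root hab hY S hS₁ hS₂
  have hportal : c.Within w (Sum.inl a) (Sum.inr c₂.root) (w s(q j, q (j + 1))) := by
    have := TreeCover.within_portal (c₁ := c₁) (c₂ := c₂) (hab := hab) (hY := hY) (hS₁ := hS₁)
      (hS₂ := hS₂) (w := w)
    rwa [ha, hroot₂] at this
  have hto₂ : ∀ z b, c₂.Within w c₂.root z b →
      c.Within w c.root (Sum.inr z) (β + w s(q j, q (j + 1)) + b) := fun z b hz =>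
    (haβ.inl.trans hportal).trans hz.inr
  have hdist : ∀ z, c.Within w c.root z (4 * cdist H w' Y x (c.π z)) := by
    rintro (z | z)
    · have h := (hdist₁ z).inl (c₁ := c₁) (c₂ := c₂) (hab := hab) (hY := hY) (hS₁ := hS₁)
        (hS₂ := hS₂)
      rwa [cdist_compl_petal hw' hc hx hq (c₁.π_mem z)] at h
    · exact (hto₂ z _ (hdist₂ z)).mono (hfar _ (c₂.π_mem z))
  have hsep : ∀ v u, ∀ p : H.Walk v u, Inside Y p → ∀ z ∈ p.support, ∀ s s', s + (r' - r) / 2 = s' →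
      (¬ InPetal H w' Y x q m s' z ∧ InPetal H w' Y x q m s v ∨
        InPetal H w' Y x q m s z ∧ ¬ InPetal H w' Y x q m s' v) →
      D / (32 * (k * l)) ≤ wlen w p := by
    intro v u p hp z hz s s' hs h
    have hv := hp v p.start_mem_support
    have hz' := hp z hz
    have h1 := cdist_le_of_mem_support hw' hp hz
    have h2 := wlen_mono hww' p
    have h3 : D / (32 * (k * l)) = D / (4 * (k * l)) / 8 := by
      field_simp
      ring
    have h4 : (r' - r) / 2 ≤ 4 * cdist H w' Y v z := by
      by_contra! hlt
      rcases h with h | h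
      · exact h.1 ((h.2.of_dist hw' hc hx hq hv hz').mono (by linarith))
      · rw [cdist_comm] at hlt
        exact h.2 ((h.1.of_dist hw' hc hx hq hz' hv).mono (by linarith))
    rw [h3]
    linarith
  refine ⟨c, hroot₁, hdist, fun ν => TreeCover.size_join .., ?_,
    fun z b hz => ⟨Sum.inl z, rfl, hz.inl⟩, fun z b hz => ⟨Sum.inr z, rfl, hto₂ z b hz⟩⟩
  -- The tree radius is at most `4 * 2D = 8D`, and `δ` is half the gap `D / (4 * k * l)` divided by
  -- the Lipschitz constant 4. Hence the stretch is `16D / δ = 512 * k * l`.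
  refine TreeCover.hasStretch_join c₁ c₂ a c₂.root hab hY S hS₁ hS₂ (B := 8 * D)
    (δ := D / (32 * (k * l))) (by positivity) (fun z => (hdist z).mono ?_) ?_ hst₁ hst₂ ?_ ?_
  · have := hR _ (c.π_mem z)
    linarith
  · refine le_of_eq ?_
    field_simp
    ring
  · intro v u p hp hS z hz hzY
    refine hsep v u p hp z hz r ((r + r') / 2) (by ring) (Or.inr ⟨?_, hS⟩)
    by_contra h
    exact hzY (Finset.mem_sdiff.2 ⟨hp z hz, fun h' => h (mem_petal.1 h').2⟩)
  · intro v u p hp hS z hz hzY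
    refine hsep v u p hp z hz ((r + r') / 2) r' (by ring) (Or.inl ⟨?_, hS⟩)
    exact fun h => hzY (mem_petal.2 ⟨hp z hz, h⟩)

end

/-! ### The recursive construction. -/

section

variable {V : Type u} {H : SimpleGraph V} {w w' : Sym2 V → ℝ} {x : V} {Y : Finset V}
  {q : ℕ → V} {m : ℕ}

/-- The edge of the ray through which it enters the petal of radius `r`. -/
lemma exists_portal (hw : ∀ e, 0 ≤ w e) (hx : x ∈ Y) (hq : IsRay H w Y x q m) {r : ℝ} (hr : 0 ≤ r)
    (hrD : r < cdist H w Y x (q m)) :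
    ∃ j < m, cdist H w Y x (q m) - cdist H w Y x (q (j + 1)) ≤ r ∧
      ∀ i < j + 1, r < cdist H w Y x (q m) - cdist H w Y x (q i) := by
  classical
  have hex : ∃ j, cdist H w Y x (q m) - cdist H w Y x (q j) ≤ r := ⟨m, by simpa using hr⟩
  have hpos : Nat.find hex ≠ 0 := fun h => by
    have := Nat.find_spec hex
    rw [h, hq.zero, cdist_self hw hx] at this
    linarith
  obtain ⟨j, hj⟩ := Nat.exists_eq_succ_of_ne_zero hpos
  have hm : Nat.find hex ≤ m := Nat.find_min' hex (by simpa using hr)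
  refine ⟨j, by omega, ?_, fun i hi => not_le.1 (Nat.find_min hex (by omega))⟩
  have := Nat.find_spec hex
  rwa [hj] at this

lemma IsHalving.mono (h : IsHalving H w w' Y q m) {Y' : Finset V} (hY : Y' ⊆ Y) :
    IsHalving H w w' Y' q m :=
  ⟨h.nonneg, h.le, fun a ha b hb => h.edge a (hY ha) b (hY hb)⟩

/-- Strong induction on the cluster, for all halved weights and protected rays at once. The stretch
constant does not deteriorate because a walk is charged only at the first split that it leaves; the
size bound adds up by the choice of radii. -/
theorem exists_cover [Finite V] (hw : ∀ e, 0 ≤ w e) {ν : V → ℝ} (hν : ∀ v, 1 ≤ ν v)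
    {k l : ℕ} (hk : 1 ≤ k) (hl : 1 ≤ l) (hN : ∑ v ∈ Y, ν v ≤ 2 ^ 2 ^ l) (hc : IsConn H Y)
    (hx : x ∈ Y) {p : ℕ → V} {n : ℕ} (hh : IsHalving H w w' Y p n) (hp : IsRay H w' Y x p n) :
    ∃ c : TreeCover H Y, c.Spans w w' x p n ∧ c.size ν ≤ (∑ v ∈ Y, ν v) ^ (1 + 1 / (k : ℝ)) ∧
      c.HasStretch w (512 * (k * l)) := by
  classical
  induction Y using Finset.strongInduction generalizing x w' p n with
  | H Y ih =>
  have hk' : (0 : ℝ) < k := by exact_mod_cast hk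
  have hl' : (0 : ℝ) < l := by exact_mod_cast hl
  have hw' := hh.nonneg
  by_cases hR : ∀ z ∈ Y, cdist H w' Y x z = 0
  · obtain ⟨c, hspan, hsize, hst⟩ := exists_cover_of_radius_eq_zero hw hc hx hh hp hR
    refine ⟨c, hspan, ?_, hst _ (by positivity)⟩
    rw [hsize]
    have h1 : 1 ≤ ∑ v ∈ Y, ν v :=
      (hν x).trans (Finset.single_le_sum (f := ν) (fun a _ => zero_le_one.trans (hν a)) hx)
    refine Real.self_le_rpow_of_one_le h1 ?_
    have : 0 ≤ 1 / (k : ℝ) := by positivity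
    linarith
  obtain ⟨t, ht, hmax⟩ := Y.exists_max_image (cdist H w' Y x) ⟨x, hx⟩
  have htpos : 0 < cdist H w' Y x t := by
    push Not at hR
    obtain ⟨z, hz, hne⟩ := hR
    exact (lt_of_le_of_ne (cdist_nonneg hw') hne.symm).trans_le (hmax z hz)
  -- Both parts are proper subsets: the complement loses the end of the ray, and the petal misses
  -- the center.
  have hsub₁ : ∀ {q m r}, IsRay H w' Y x q m → 0 ≤ r → Y \ petal H w' Y x q m r ⊂ Y :=
    fun {q m r} hq hr => Finset.sdiff_ssubset petal_subset
      ⟨q m, mem_petal.2 ⟨hq.mem m le_rfl, ray_inPetal hw' hq le_rfl (by simpa using hr)⟩⟩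
  have hsub₂ : ∀ {q m r}, IsRay H w' Y x q m → r < cdist H w' Y x (q m) →
      petal H w' Y x q m r ⊂ Y := fun {q m r} hq hr => by
    refine (Finset.ssubset_iff_of_subset petal_subset).2 ⟨x, hx, fun h => ?_⟩
    exact not_inPetal hw' hc hx hq hx (by simpa [cdist_self hw' hx] using hr) (mem_petal.1 h).2
  have hsum : ∀ {Y'}, Y' ⊂ Y → ∑ v ∈ Y', ν v ≤ 2 ^ 2 ^ l := fun {Y'} h =>
    (Finset.sum_le_sum_of_subset_of_nonneg h.1
      fun v _ _ => zero_le_one.trans (hν v)).trans hN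
  by_cases hP : cdist H w' Y x t ≤ 2 * cdist H w' Y x (p n)
  · -- the petal around the end of the protected ray; no further halving
    have hD : 0 < cdist H w' Y x (p n) := by linarith
    obtain ⟨r, r', hr, hrr', hlt, hr'D, hcut⟩ := exists_petal_radii hw' hc hx hp hD hν hk hl hN
    obtain ⟨j, hj, hjr, hjcut⟩ := exists_portal hw' hx hp (hr.trans hlt.le) (by linarith)
    obtain ⟨j', hj', hjr', hjcut'⟩ := exists_portal hw' hx hp hr (by linarith)
    -- The ray enters the large petal after `p j` and the small one after `p j'`. The two protected
    -- pieces `p 0, …, p j'` and `p (j + 1), …, p n` therefore cover the ray.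
    have hjj' : j + 1 ≤ j' + 1 := cutoff_le hjcut (hjr'.trans hlt.le)
    have hmem₁ : ∀ i ≤ j', p i ∈ Y \ petal H w' Y x p n r := fun i hi =>
      Finset.mem_sdiff.2 ⟨hp.mem i (by omega), fun h =>
        not_inPetal hw' hc hx hp (hp.mem i (by omega)) (hjcut' i (by omega)) (mem_petal.1 h).2⟩
    have hh₁ : IsHalving H w w' (Y \ petal H w' Y x p n r) p j' := by
      refine ⟨hh.nonneg, hh.le, fun a ha b hb hab => ?_⟩
      refine (hh.edge a (Finset.sdiff_subset ha) b (Finset.sdiff_subset hb) hab).imp_right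
        fun ⟨h1, i, hi, he⟩ => ⟨h1, i, ?_, he⟩
      have hmem : p (i + 1) ∈ Y \ petal H w' Y x p n r := by
        rcases Sym2.eq_iff.1 he with ⟨-, rfl⟩ | ⟨rfl, -⟩
        exacts [hb, ha]
      by_contra! hij
      refine (Finset.mem_sdiff.1 hmem).2 (mem_petal.2 ⟨hp.mem _ hi, ray_inPetal hw' hp hi ?_⟩)
      have := hp.dist_mono hw' (Nat.succ_le_succ hij) hi
      linarith
    have hray₁ := isRay_compl_petal hw' hc hx hp hp hj'.le hmem₁
    have hh₂ : IsHalving H w w' (petal H w' Y x p n r') (fun i => p (j + 1 + i)) (n - (j + 1)) := by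
      refine ⟨hh.nonneg, hh.le, fun a ha b hb hab => ?_⟩
      refine (hh.edge a (petal_subset ha) b (petal_subset hb) hab).imp_right
        fun ⟨h1, i, hi, he⟩ => ⟨h1, i - (j + 1), ?_⟩
      have hmem : p i ∈ petal H w' Y x p n r' := by
        rcases Sym2.eq_iff.1 he with ⟨rfl, -⟩ | ⟨-, rfl⟩
        exacts [ha, hb]
      have hji : j + 1 ≤ i := cutoff_le hjcut (by
        by_contra! h
        exact not_inPetal hw' hc hx hp (hp.mem i hi.le) h (mem_petal.1 hmem).2)
      have hi' : j + 1 + (i - (j + 1)) = i := by omega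
      exact ⟨by omega, by simp only [← add_assoc, hi', he]⟩
    obtain ⟨hray₂, hd₂⟩ := isRay_petal hw' hc hx hp hw' (c := 1) (by simp) zero_le_one (by simp) hj
      hjr hjcut
    obtain ⟨c₁, hs₁, hz₁, ht₁⟩ := ih _ (hsub₁ hp hr) (hsum (hsub₁ hp hr))
      (isConn_compl_petal hw' hc hx hp) (by simpa [hp.zero] using hmem₁ 0 (by omega)) hh₁ hray₁
    obtain ⟨c₂, hs₂, hz₂, ht₂⟩ := ih _ (hsub₂ hp (by linarith)) (hsum (hsub₂ hp (by linarith)))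
      (isConn_petal hw' hc hx hp hjr hjcut) (by simpa using hray₂.mem 0 (by omega)) hh₂ hray₂
    obtain ⟨a, ha, haβ⟩ := hs₁.ray j (by omega)
    rw [cdist_compl_petal hw' hc hx hp (hmem₁ j (by omega))] at haβ
    -- The portal edge may already be halved. Its true weight is at most twice the current one,
    -- which fits the factor 2 kept along the protected ray.
    have hwe := hh.le_two_mul (hp.mem j hj.le) (hp.mem (j + 1) hj) (hp.adj j hj)
    have hde := hp.dist j hj
    obtain ⟨c, hroot, hdist, hsize, hst, hto₁, hto₂⟩ := exists_join hw' hh.le hc hx hp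
      (fun z hz => (hmax z hz).trans hP) hk hl hrr' hlt hj c₁ c₂ hs₁.root hs₁.dist hs₂.root hs₂.dist
      ht₁ ht₂ ha haβ (by
        intro z hz
        obtain ⟨i, hji, hi, hi', hle⟩ := cdist_petal_le hw' hc hx hp hw' (fun e => le_rfl) hjr
          hjcut hz
        rw [hp.sum_eq hji hi] at hle
        -- The distance to the petal's root carries only the factor 2, and `2 * r' ≤ D` absorbs the
        -- factor 4 on the rest of the ray.
        have := hp.dist_mono hw' hi le_rfl
        linarith)
    refine ⟨c, ⟨hroot, hdist, fun i hi => ?_⟩, ?_, hst⟩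
    · by_cases hij : i ≤ j'
      · obtain ⟨z, hz, hzw⟩ := hs₁.ray i hij
        rw [cdist_compl_petal hw' hc hx hp (hmem₁ i hij)] at hzw
        obtain ⟨z', hz', hzw'⟩ := hto₁ z _ hzw
        exact ⟨z', hz'.trans hz, hzw'⟩
      · obtain ⟨z, hz, hzw⟩ := hs₂.ray (i - (j + 1)) (by omega)
        have hi' : j + 1 + (i - (j + 1)) = i := by omega
        simp only [hi'] at hz hzw
        rw [hd₂ i (by omega) hi] at hzw
        obtain ⟨z', hz', hzw'⟩ := hto₂ z _ hzw
        exact ⟨z', hz'.trans hz, hzw'.mono (by linarith)⟩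
    · rw [hsize]
      linarith
  · -- the petal around a farthest point; the weights on its ray are halved
    push Not at hP
    obtain ⟨q, m, hq, rfl⟩ := exists_ray hw' hc hx ht
    obtain ⟨r, r', hr, hrr', hlt, hr'D, hcut⟩ := exists_petal_radii hw' hc hx hq htpos hν hk hl hN
    obtain ⟨j, hj, hjr, hjcut⟩ := exists_portal hw' hx hq (hr.trans hlt.le) (by linarith)
    -- The protected ray stays within distance less than `D / 2` of `x`, whereas the petal contains
    -- only points at distance at least `D - r' ≥ D / 2`.
    have hpout : ∀ i ≤ n, ∀ s ≤ r', ¬ InPetal H w' Y x q m s (p i) := fun i hi s hs => by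
      refine not_inPetal hw' hc hx hq (hp.mem i hi) ?_
      have := hp.dist_mono hw' hi le_rfl
      linarith
    have hmem₁ : ∀ i ≤ n, p i ∈ Y \ petal H w' Y x q m r := fun i hi =>
      Finset.mem_sdiff.2 ⟨hp.mem i hi, fun h => hpout i hi r hlt.le (mem_petal.1 h).2⟩
    have hray₁ := isRay_compl_petal hw' hc hx hq hp le_rfl hmem₁
    let w'' : Sym2 V → ℝ := fun e =>
      if ∃ i, j + 1 ≤ i ∧ i < m ∧ e = s(q i, q (i + 1)) then 1 / 2 * w' e else w' e
    have hw''0 : ∀ e, 0 ≤ w'' e := fun e => by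
      have := hw' e
      dsimp only [w'']
      split_ifs <;> linarith
    have hw''le : ∀ e, w'' e ≤ w' e := fun e => by
      have := hw' e
      dsimp only [w'']
      split_ifs <;> linarith
    have hw''ge : ∀ e, 1 / 2 * w' e ≤ w'' e := fun e => by
      have := hw' e
      dsimp only [w'']
      split_ifs <;> linarith
    have hw''ray : ∀ i, j + 1 ≤ i → i < m →
        w'' s(q i, q (i + 1)) = 1 / 2 * w' s(q i, q (i + 1)) :=
      fun i h1 h2 => if_pos ⟨i, h1, h2, rfl⟩
    -- Halved edges have both ends on the protected ray, so an edge touching the petal still has its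
    -- original weight.
    have hweq : ∀ a ∈ Y, ∀ b ∈ Y, H.Adj a b →
        (a ∈ petal H w' Y x q m r' ∨ b ∈ petal H w' Y x q m r') → w' s(a, b) = w s(a, b) := by
      intro a ha b hb hab hmem
      refine (hh.edge a ha b hb hab).resolve_right fun ⟨_, i, hi, he⟩ => ?_
      have h1 := hpout i hi.le r' le_rfl
      have h2 := hpout (i + 1) hi r' le_rfl
      rcases Sym2.eq_iff.1 he with ⟨rfl, rfl⟩ | ⟨rfl, rfl⟩ <;> rcases hmem with h | h
      exacts [h1 (mem_petal.1 h).2, h2 (mem_petal.1 h).2, h2 (mem_petal.1 h).2,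
        h1 (mem_petal.1 h).2]
    have hh₂ : IsHalving H w w'' (petal H w' Y x q m r') (fun i => q (j + 1 + i))
        (m - (j + 1)) := by
      refine ⟨hw''0, fun e => (hw''le e).trans (hh.le e), fun a ha b hb hab => ?_⟩
      rw [← hweq a (petal_subset ha) b (petal_subset hb) hab (Or.inl ha)]
      by_cases he : ∃ i, j + 1 ≤ i ∧ i < m ∧ s(a, b) = s(q i, q (i + 1))
      · obtain ⟨i, h1, h2, he⟩ := he
        refine Or.inr ⟨?_, i - (j + 1), by omega, ?_⟩
        · have := hw''ge s(a, b)
          linarith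
        · have : j + 1 + (i - (j + 1)) = i := by omega
          simp only [← add_assoc, this, he]
      · exact Or.inl (if_neg he)
    obtain ⟨hray₂, hd₂⟩ := isRay_petal hw' hc hx hq hw''0 hw''ge (by norm_num) hw''ray hj
      hjr hjcut
    obtain ⟨c₁, hs₁, hz₁, ht₁⟩ := ih _ (hsub₁ hq hr) (hsum (hsub₁ hq hr))
      (isConn_compl_petal hw' hc hx hq) (by simpa [hp.zero] using hmem₁ 0 (by omega))
      (hh.mono Finset.sdiff_subset) hray₁
    obtain ⟨c₂, hs₂, hz₂, ht₂⟩ := ih _ (hsub₂ hq (by linarith)) (hsum (hsub₂ hq (by linarith)))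
      (isConn_petal hw' hc hx hq hjr hjcut) (by simpa using hray₂.mem 0 (by omega)) hh₂ hray₂
    have hjmem : q j ∈ Y \ petal H w' Y x q m r :=
      Finset.mem_sdiff.2 ⟨hq.mem j hj.le, fun h => not_inPetal hw' hc hx hq (hq.mem j hj.le)
        (hlt.trans (hjcut j (by omega))) (mem_petal.1 h).2⟩
    obtain ⟨a, ha⟩ := (c₁.range _).1 hjmem
    have haβ := hs₁.dist a
    rw [ha, cdist_compl_petal hw' hc hx hq hjmem] at haβ
    have hwe := hweq (q j) (hq.mem j hj.le) (q (j + 1)) (hq.mem (j + 1) hj) (hq.adj j hj)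
      (Or.inr (mem_petal.2 ⟨hq.mem _ hj, ray_inPetal hw' hq hj hjr⟩))
    have hde := hq.dist j hj
    obtain ⟨c, hroot, hdist, hsize, hst, hto₁, -⟩ := exists_join hw' hh.le hc hx hq
      (fun z hz => by linarith [hmax z hz]) hk hl hrr' hlt hj c₁ c₂ hs₁.root hs₁.dist hs₂.root
      hs₂.dist ht₁ ht₂ ha haβ (by
        intro z hz
        obtain ⟨i, hji, hi, hi', hle⟩ := cdist_petal_le hw' hc hx hq hw''0 hw''le hjr hjcut hz
        have hsum : ∑ l ∈ Finset.Ico (j + 1) i, w'' s(q l, q (l + 1)) =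
            1 / 2 * (cdist H w' Y x (q i) - cdist H w' Y x (q (j + 1))) := by
          rw [← hq.sum_eq hji hi, Finset.mul_sum]
          refine Finset.sum_congr rfl fun l hl => ?_
          rw [Finset.mem_Ico] at hl
          exact hw''ray l hl.1 (by omega)
        rw [hsum] at hle
        -- The root of the petal is reached with factor 4, but the halved ray inside it effectively
        -- costs only 2. The bound closes because `q j` lies more than `r'` closer to `x` than the
        -- end of the ray.
        have := hjcut j (by omega)
        have := hq.dist_mono hw' j.le_succ hj
        linarith)
    refine ⟨c, ⟨hroot, hdist, fun i hi => ?_⟩, ?_, hst⟩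
    · obtain ⟨z, hz, hzw⟩ := hs₁.ray i hi
      rw [cdist_compl_petal hw' hc hx hq (hmem₁ i hi)] at hzw
      obtain ⟨z', hz', hzw'⟩ := hto₁ z _ hzw
      exact ⟨z', hz'.trans hz, hzw'⟩
    · rw [hsize]
      linarith

end

/-! ### From tree covers to spanning clan embeddings. -/

section

section WeightedGraph

variable {V : Type*} (G : WeightedGraph V) {x y : V}

/-- Weights off the edge set are arbitrary; absolute values give the global nonnegativity used in
the construction without changing any walk length. -/
lemma walkLength_eq_wlen_abs (p : G.graph.Walk x y) :
    G.walkLength p = wlen (fun e => |G.weight e|) p := by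
  unfold WeightedGraph.walkLength wlen
  congr 1
  refine List.map_congr_left fun e he => (abs_of_nonneg (G.weight_nonneg e ?_)).symm
  exact p.edges_subset_edgeSet he

lemma walkLength_nonneg (p : G.graph.Walk x y) : 0 ≤ G.walkLength p := by
  rw [walkLength_eq_wlen_abs]
  exact wlen_nonneg (fun e => abs_nonneg _) p

lemma dist_le_walkLength (p : G.graph.Walk x y) : G.dist x y ≤ G.walkLength p :=
  ciInf_le ⟨0, by rintro _ ⟨p, rfl⟩; exact walkLength_nonneg G p⟩ p

lemma dist_nonneg : 0 ≤ G.dist x y := Real.iInf_nonneg fun p => walkLength_nonneg G p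

lemma hasMultDistortion_mono {Y : Type*} {dY : Y → Y → ℝ} {f : V → Finset Y} {χ : V → Y} {t t' : ℝ}
    (ht : t ≤ t') (h : HasMultDistortion G.dist dY f χ t) :
    HasMultDistortion G.dist dY f χ t' := fun x y => by
  obtain ⟨z, hz, hd⟩ := h x y
  exact ⟨z, hz, hd.trans (mul_le_mul_of_nonneg_right ht (dist_nonneg G))⟩

end WeightedGraph

/-- The projection is a homomorphism and tree weights are pulled back along it. Tree walks thus
project to walks of equal length in `G`, which gives domination. -/
lemma TreeCover.exists_spanningClanTree {V : Type u} [Fintype V] (G : WeightedGraph V)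
    (hG : G.graph.Connected) (c : TreeCover G.graph (Finset.univ : Finset V)) {t : ℝ} (ht : 0 ≤ t)
    (hst : c.HasStretch (fun e => |G.weight e|) t) :
    ∃ e : SpanningClanTree G, e.HasDistortion t ∧
      ∀ ν : V → ℝ, ∑ v, ν v * ((e.f v).card : ℝ) = c.size ν := by
  classical
  let σ : c.W ≃ Fin (Fintype.card c.W) := Fintype.equivFin c.W
  let iso : c.T.comap σ.symm ≃g c.T := Iso.comap σ.symm c.T
  let ψ : c.T.comap σ.symm →g G.graph := c.π.comp iso.toHom
  let T : WeightedGraph (Fin (Fintype.card c.W)) :=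
    { graph := c.T.comap σ.symm
      weight := fun e => G.weight (Sym2.map ψ e)
      weight_nonneg := fun e he => G.weight_nonneg _ (ψ.map_mem_edgeSet he) }
  have hmap : ∀ {a b} (p : T.graph.Walk a b), G.walkLength (p.map ψ) = T.walkLength p :=
    fun p => wlen_map ψ p
  have hT : T.graph.IsTree := iso.isTree_iff.2 c.isTree
  have hmem : ∀ v i, i ∈ Finset.univ.filter (fun i => ψ i = v) ↔ ψ i = v := by simp
  have hwithin : ∀ a b l, c.Within (fun e => |G.weight e|) a b l → T.dist (σ a) (σ b) ≤ l := by
    rintro a b l ⟨p, hp⟩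
    refine (dist_le_walkLength T (p.map iso.symm.toHom)).trans (le_of_eq_of_le ?_ hp)
    rw [← hmap, walkLength_eq_wlen_abs, wlen_map, wlen_map]
    congr 1
    ext e
    induction e with | _ u v =>
    simp [ψ, iso]
  let e : SpanningClanTree G :=
    { m := Fintype.card c.W
      T := T
      isTree := hT
      f := fun v => Finset.univ.filter fun i => ψ i = v
      χ := fun v => σ (c.χ v)
      isClan :=
        { oneToMany :=
            { nonempty := fun v => by
                obtain ⟨a, ha⟩ := (c.range v).1 (Finset.mem_univ v)
                exact ⟨σ a, (hmem v _).2 (by simpa [ψ, iso] using ha)⟩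
              disjoint := fun v v' hv => Finset.disjoint_left.2 fun i hi hi' =>
                hv (((hmem v i).1 hi).symm.trans ((hmem v' i).1 hi')) }
          dominating := fun v v' i hi i' hi' => by
            rw [hmem] at hi hi'
            subst hi hi'
            have : Nonempty (T.graph.Walk i i') := hT.connected.preconnected i i'
            exact le_ciInf fun p => (dist_le_walkLength G _).trans_eq (hmap p)
          chief_mem := fun v => (hmem v _).2 (by
            simpa [ψ, iso] using c.π_χ v (Finset.mem_univ v)) }
      isSpanning :=
        { onto := fun i => ⟨ψ i, (hmem _ _).2 rfl⟩
          edges := fun i i' h v v' hi hi' => by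
            rw [hmem] at hi hi'
            subst hi hi'
            exact ⟨ψ.map_adj h, rfl⟩ } }
  refine ⟨e, fun v u => ?_, fun ν => ?_⟩
  · obtain ⟨p₀⟩ := hG.preconnected v u
    obtain ⟨p, hp, hmin⟩ := exists_shortest (w := fun e => |G.weight e|) (Y := Finset.univ)
      (fun e => abs_nonneg _) ⟨p₀, fun z _ => Finset.mem_univ z⟩
    have hpd : wlen (fun e => |G.weight e|) p ≤ G.dist v u := by
      have : Nonempty (G.graph.Walk v u) := ⟨p₀⟩
      refine le_ciInf fun p' => ?_
      rw [walkLength_eq_wlen_abs]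
      exact hmin p' fun z _ => Finset.mem_univ z
    obtain ⟨a, ha, haw⟩ := hst v u p hp
    refine ⟨σ a, (hmem u _).2 (by simpa [ψ, iso] using ha), (hwithin _ _ _ haw.symm).trans ?_⟩
    exact mul_le_mul_of_nonneg_left hpd ht
  · change ∑ v, ν v * ((Finset.univ.filter fun i => ψ i = v).card : ℝ) = _
    have h1 : ∑ i, ν (ψ i) = c.size ν := Equiv.sum_comp σ.symm fun a => ν (c.π a)
    rw [← h1, ← Finset.sum_fiberwise Finset.univ ψ]
    refine Finset.sum_congr rfl fun v _ => ?_
    rw [Finset.sum_congr rfl (g := fun _ => ν v) fun i hi => by rw [(hmem v i).1 hi],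
      Finset.sum_const, nsmul_eq_mul, mul_comm]

theorem exists_spanningClanTree {V : Type u} [Fintype V] (G : WeightedGraph V)
    (hG : G.graph.Connected) {ν : V → ℝ} (hν : ∀ v, 1 ≤ ν v)
    {k l : ℕ} (hk : 1 ≤ k) (hl : 1 ≤ l) (hN : ∑ v, ν v ≤ 2 ^ 2 ^ l) :
    ∃ e : SpanningClanTree G, e.HasDistortion (512 * (k * l)) ∧
      ∑ v, ν v * ((e.f v).card : ℝ) ≤ (∑ v, ν v) ^ (1 + 1 / (k : ℝ)) := by
  obtain ⟨x⟩ := hG.nonempty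
  have hc : IsConn G.graph (Finset.univ : Finset V) := fun a _ b _ => by
    obtain ⟨p⟩ := hG.preconnected a b
    exact ⟨p, fun z _ => Finset.mem_univ z⟩
  -- Initially nothing is halved, and the protected ray consists of a single vertex.
  obtain ⟨c, -, hsize, hst⟩ := exists_cover (w := fun e => |G.weight e|)
    (w' := fun e => |G.weight e|) (p := fun _ => x) (n := 0) (fun e => abs_nonneg _) hν hk hl hN hc
    (Finset.mem_univ x) ⟨fun e => abs_nonneg _, fun e => le_rfl, fun _ _ _ _ _ => Or.inl rfl⟩
    ⟨rfl, fun _ _ => Finset.mem_univ _, by simp, by simp⟩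
  obtain ⟨e, he, hes⟩ := c.exists_spanningClanTree G hG (by positivity) hst
  exact ⟨e, he, (hes ν).trans_le hsize⟩

/-! ### Minimax. -/

/-- Minimax: if every weighting of `V` admits an element of small average cost, then some
distribution has small expected cost at every point. -/
theorem exists_pmf_expectation_le {V E : Type*} [Fintype V] [Nonempty V] (c : E → V → ℕ)
    (P : E → Prop) (A : ℕ) (B : ℝ)
    (h : ∀ μ : V → ℝ, (∀ v, 0 ≤ μ v) → ∑ v, μ v = 1 →
      ∃ e, P e ∧ (∀ v, c e v ≤ A) ∧ ∑ v, μ v * (c e v : ℝ) ≤ B) :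
    ∃ D : PMF E, (∀ e ∈ D.support, P e) ∧
      ∀ v, ∑' e, D e * (c e v : ℝ≥0∞) ≤ ENNReal.ofReal B := by
  classical
  let S : Set (V → ℝ) := {x | ∃ e, P e ∧ (∀ v, c e v ≤ A) ∧ ∀ v, x v = c e v}
  -- The bound `A` serves only here: finitely many cost vectors make the convex hull compact, so it
  -- can be strictly separated from the orthant.
  have hfin : S.Finite := by
    refine (Set.finite_range fun (g : V → Fin (A + 1)) v => ((g v : ℕ) : ℝ)).subset ?_
    rintro x ⟨e, -, hA, hx⟩
    exact ⟨fun v => ⟨c e v, Nat.lt_succ_of_le (hA v)⟩, funext fun v => (hx v).symm⟩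
  have hex : ∃ x ∈ convexHull ℝ S, x ∈ Set.Iic (fun _ : V => B) := by
    by_contra! hcon
    obtain ⟨f, s, t, hfs, hst, hft⟩ := geometric_hahn_banach_compact_closed (convex_convexHull ℝ S)
      (Set.Finite.isCompact_convexHull (𝕜 := ℝ) hfin) (convex_Iic (fun _ : V => B)) isClosed_Iic
      (Set.disjoint_left.2 hcon)
    let μ : V → ℝ := fun v => -f (Pi.single v 1)
    have hf : ∀ x : V → ℝ, f x = -∑ v, μ v * x v := fun x => by
      have := LinearMap.pi_apply_eq_sum_univ (f : (V → ℝ) →ₗ[ℝ] ℝ) x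
      simp only [ContinuousLinearMap.coe_coe] at this
      rw [this, ← Finset.sum_neg_distrib]
      refine Finset.sum_congr rfl fun v _ => ?_
      have : (fun j => if v = j then (1 : ℝ) else 0) = Pi.single v 1 := by
        ext j
        simp [Pi.single_apply, eq_comm]
      rw [this, smul_eq_mul]
      simp only [μ]
      ring
    have hB := hft (fun _ => B) (Set.mem_Iic.2 le_rfl)
    have hμ : ∀ v, 0 ≤ μ v := by
      intro v
      by_contra! hv
      have hr : 0 ≤ (f (fun _ => B) - t) / -μ v :=
        div_nonneg (by linarith) (by linarith)
      -- The orthant is unbounded below. A negative `μ v` would allow moving along coordinate `v`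
      -- until `f` drops exactly to `t`.
      have := hft ((fun _ => B) - ((f (fun _ => B) - t) / -μ v) • Pi.single v 1) (by
        have h1 : (0 : V → ℝ) ≤ Pi.single v 1 := Pi.single_nonneg.2 zero_le_one
        exact Set.mem_Iic.2 (sub_le_self _ (smul_nonneg hr h1)))
      have hv' : f (Pi.single v 1) = -μ v := by simp [μ]
      rw [map_sub, map_smul, hv', smul_eq_mul, div_mul_cancel₀ _ (by linarith)] at this
      linarith
    have hS : ∀ e, P e → (∀ v, c e v ≤ A) → B * ∑ v, μ v < ∑ v, μ v * (c e v : ℝ) := by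
      intro e he hA
      have h1 := hfs _ (subset_convexHull ℝ S ⟨e, he, hA, fun v => rfl⟩)
      rw [hf] at h1 hB
      rw [← Finset.sum_mul] at hB
      linarith
    rcases (Finset.sum_nonneg fun v _ => hμ v : 0 ≤ ∑ v, μ v).eq_or_lt with h0 | h0
    -- Here the separating functional vanishes; a point mass supplies some admissible element, for
    -- which the strict separation reads `0 < 0`.
    · obtain ⟨v₀⟩ := ‹Nonempty V›
      obtain ⟨e, he, hA, -⟩ := h (Pi.single v₀ 1)
        (fun v => by by_cases hv : v = v₀ <;> simp [hv]) (by simp)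
      have h1 := hS e he hA
      have h2 : ∀ v, μ v = 0 := fun v =>
        (Finset.sum_eq_zero_iff_of_nonneg fun v _ => hμ v).1 h0.symm v (Finset.mem_univ v)
      simp [h2] at h1
    · obtain ⟨e, he, hA, hle⟩ := h (fun v => μ v / ∑ v, μ v) (fun v => div_nonneg (hμ v) h0.le)
        (by rw [← Finset.sum_div, div_self h0.ne'])
      have h1 := hS e he hA
      simp only [div_mul_eq_mul_div] at hle
      rw [← Finset.sum_div, div_le_iff₀ h0] at hle
      linarith
  obtain ⟨x, hx, hxB⟩ := hex
  obtain ⟨ι, _, w, z, hw0, hw1, hz, hwx⟩ := mem_convexHull_iff_exists_fintype.1 hx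
  choose g hgP _ hg using hz
  have hsum : ∑ i, ENNReal.ofReal (w i) = 1 := by
    rw [← ENNReal.ofReal_sum_of_nonneg fun i _ => hw0 i, hw1, ENNReal.ofReal_one]
  refine ⟨(PMF.ofFintype (fun i => ENNReal.ofReal (w i)) hsum).map g, ?_, fun v => ?_⟩
  · intro e he
    obtain ⟨i, -, rfl⟩ := (PMF.mem_support_map_iff _ _ _).1 he
    exact hgP i
  · have hexp : ∑' e, ((PMF.ofFintype (fun i => ENNReal.ofReal (w i)) hsum).map g) e *
        (c e v : ℝ≥0∞) = ∑ i, ENNReal.ofReal (w i) * (c (g i) v : ℝ≥0∞) := by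
      simp only [PMF.map_apply, PMF.ofFintype_apply, ← ENNReal.tsum_mul_right]
      rw [ENNReal.tsum_comm, tsum_fintype]
      refine Finset.sum_congr rfl fun i _ => ?_
      rw [tsum_eq_single (g i) fun e he => by simp [he]]
      simp
    rw [hexp]
    refine le_of_eq_of_le ?_ (ENNReal.ofReal_le_ofReal (Set.mem_Iic.1 hxB v))
    rw [← hwx, Finset.sum_apply, ENNReal.ofReal_sum_of_nonneg fun i _ => by
      rw [Pi.smul_apply, hg, smul_eq_mul]
      exact mul_nonneg (hw0 i) (Nat.cast_nonneg _)]
    refine Finset.sum_congr rfl fun i _ => ?_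
    rw [Pi.smul_apply, hg, smul_eq_mul, ENNReal.ofReal_mul (hw0 i), ENNReal.ofReal_natCast]

end

/-! ### Choice of parameters and constants. -/

section

lemma three_halves_le_logb {n : ℕ} (hn : 3 ≤ n) : 3 / 2 ≤ Real.logb 2 n := by
  have hn' : (3 : ℝ) ≤ n := by exact_mod_cast hn
  have h : Real.logb 2 8 ≤ Real.logb 2 ((n : ℝ) ^ 2) :=
    Real.logb_le_logb_of_le (by norm_num) (by norm_num) (by nlinarith)
  rw [Real.logb_pow, show (8 : ℝ) = 2 ^ (3 : ℕ) by norm_num, Real.logb_pow,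
    Real.logb_self_eq_one (by norm_num)] at h
  push_cast at h
  linarith

lemma half_le_logb_logb {n : ℕ} (hn : 3 ≤ n) : 1 / 2 ≤ Real.logb 2 (Real.logb 2 n) := by
  have hx := three_halves_le_logb hn
  have h : Real.logb 2 2 ≤ Real.logb 2 ((Real.logb 2 n) ^ 2) :=
    Real.logb_le_logb_of_le (by norm_num) (by norm_num) (by nlinarith)
  rw [Real.logb_pow, Real.logb_self_eq_one (by norm_num)] at h
  push_cast at h
  linarith

lemma logb_two_mul {n : ℕ} (hn : 3 ≤ n) : Real.logb 2 (2 * n) = 1 + Real.logb 2 n := by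
  have hn' : (3 : ℝ) ≤ n := by exact_mod_cast hn
  rw [Real.logb_mul (by norm_num) (by linarith), Real.logb_self_eq_one (by norm_num)]

lemma exists_double_exponent {n : ℕ} (hn : 3 ≤ n) :
    ∃ l : ℕ, 1 ≤ l ∧ (2 * n : ℝ) ≤ 2 ^ 2 ^ l ∧ (l : ℝ) ≤ 5 * Real.logb 2 (Real.logb 2 n) := by
  have hn' : (3 : ℝ) ≤ n := by exact_mod_cast hn
  have hx := three_halves_le_logb hn
  have hxx := half_le_logb_logb hn
  have h2 := logb_two_mul hn
  set L := Real.logb 2 (2 * n : ℝ) with hL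
  have hLL : 1 < Real.logb 2 L := by
    rw [Real.lt_logb_iff_rpow_lt (by norm_num) (by linarith), Real.rpow_one]
    linarith
  have hLn : Real.logb 2 L ≤ 1 + Real.logb 2 (Real.logb 2 n) := by
    have : Real.logb 2 L ≤ Real.logb 2 (2 * Real.logb 2 n) :=
      Real.logb_le_logb_of_le (by norm_num) (by linarith) (by linarith)
    rwa [Real.logb_mul (by norm_num) (by linarith), Real.logb_self_eq_one (by norm_num)] at this
  refine ⟨⌈Real.logb 2 L⌉₊, Nat.one_le_ceil_iff.2 (by linarith), ?_, ?_⟩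
  · have h3 : L ≤ 2 ^ ⌈Real.logb 2 L⌉₊ := by
      rw [← Real.rpow_natCast, ← Real.logb_le_iff_le_rpow (by norm_num) (by linarith)]
      exact Nat.le_ceil _
    rw [hL, Real.logb_le_iff_le_rpow (by norm_num) (by linarith)] at h3
    refine h3.trans_eq ?_
    generalize ⌈Real.logb 2 L⌉₊ = m
    exact_mod_cast Real.rpow_natCast 2 (2 ^ m)
  · have := Nat.ceil_lt_add_one (show 0 ≤ Real.logb 2 L by linarith)
    linarith

/-- The vertex weights `1 + n * μ v` are at least 1 and have total `2 * n`. The constant is `2560 =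
512 * 5`, with 5 from the bound on `l`; the crude bound on the clans is for the minimax argument. -/
lemma exists_spanningClanTree_of_weighting {V : Type u} [Fintype V] (G : WeightedGraph V) {n : ℕ}
    (hG : G.graph.Connected) (hcard : Fintype.card V = n) (hn : 3 ≤ n) {k : ℕ} (hk : 1 ≤ k)
    {μ : V → ℝ} (hμ : ∀ v, 0 ≤ μ v) (hμ1 : ∑ v, μ v = 1) :
    ∃ e : SpanningClanTree G,
      e.HasDistortion (2560 * (k * Real.logb 2 (Real.logb 2 n))) ∧
      (∀ v, (e.f v).card ≤ (2 * n) ^ 2) ∧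
      ∑ v, (1 + n * μ v) * ((e.f v).card : ℝ) ≤ 2 * n * (2 * n : ℝ) ^ (1 / (k : ℝ)) := by
  have hn' : (3 : ℝ) ≤ n := by exact_mod_cast hn
  have hk' : (1 : ℝ) ≤ k := by exact_mod_cast hk
  obtain ⟨l, hl, hN, hll⟩ := exists_double_exponent hn
  have hsum : ∑ v, (1 + n * μ v) = 2 * n := by
    rw [Finset.sum_add_distrib, ← Finset.mul_sum, hμ1]
    simp only [Finset.sum_const, Finset.card_univ, hcard, nsmul_eq_mul]
    ring
  have hν : ∀ v, 1 ≤ 1 + n * μ v := fun v => by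
    have := mul_nonneg (by linarith : (0 : ℝ) ≤ n) (hμ v)
    linarith
  obtain ⟨e, he, hes⟩ := exists_spanningClanTree G hG hν hk hl (hsum.trans_le hN)
  rw [hsum, Real.rpow_add (by linarith), Real.rpow_one] at hes
  refine ⟨e, hasMultDistortion_mono G ?_ he, fun v => ?_, hes⟩
  · have := mul_le_mul_of_nonneg_left hll (by linarith : (0 : ℝ) ≤ k)
    linarith
  · have h1 : ((e.f v).card : ℝ) ≤ ∑ v, (1 + n * μ v) * ((e.f v).card : ℝ) := by
      refine le_trans ?_ (Finset.single_le_sum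
        (f := fun v => (1 + n * μ v) * ((e.f v).card : ℝ)) (fun v _ => ?_) (Finset.mem_univ v))
      · exact le_mul_of_one_le_left (Nat.cast_nonneg _) (hν v)
      · exact mul_nonneg (zero_le_one.trans (hν v)) (Nat.cast_nonneg _)
    have h2 : (2 * n : ℝ) ^ (1 / (k : ℝ)) ≤ 2 * n :=
      (Real.rpow_le_rpow_of_exponent_le (by linarith) (by
        rw [div_le_one (by linarith)]
        exact hk')).trans_eq (Real.rpow_one _)
    have h3 : 2 * n * (2 * n : ℝ) ^ (1 / (k : ℝ)) ≤ 2 * n * (2 * n) :=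
      mul_le_mul_of_nonneg_left h2 (by linarith)
    have h4 : ((e.f v).card : ℝ) ≤ ((2 * n) ^ 2 : ℕ) := by
      push_cast
      nlinarith
    exact_mod_cast h4

end

end ClanTree


open ClanTree in
theorem theorem3 :
    ∃ C : ℝ, 0 < C ∧
      ∀ (V : Type u) [Fintype V] (G : WeightedGraph V) (n : ℕ),
        G.graph.Connected → Fintype.card V = n → 3 ≤ n →
        (∀ ε : ℝ, 0 < ε → ε ≤ 1 →
          ∃ D : PMF (SpanningClanTree G),
            (∀ e ∈ D.support,
              e.HasDistortion (C * (Real.logb 2 n * Real.logb 2 (Real.logb 2 n) / ε))) ∧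
            ∀ v, expectedClanSize D v ≤ ENNReal.ofReal (1 + ε)) ∧
        (∀ k : ℕ, 1 ≤ k →
          ∃ D : PMF (SpanningClanTree G),
            (∀ e ∈ D.support,
              e.HasDistortion (C * (k * Real.logb 2 (Real.logb 2 n)))) ∧
            ∀ v, expectedClanSize D v ≤ ENNReal.ofReal (C * (n : ℝ) ^ ((1 : ℝ) / k))) := by
  refine ⟨12800, by norm_num, fun V _ G n hG hcard hn => ?_⟩
  have hn' : (3 : ℝ) ≤ n := by exact_mod_cast hn
  have hx := three_halves_le_logb hn
  have hxx := half_le_logb_logb hn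
  have h2n := logb_two_mul hn
  have := hG.nonempty
  refine ⟨fun ε hε hε1 => ?_, fun k hk => ?_⟩
  · refine exists_pmf_expectation_le (fun (e : SpanningClanTree G) v => (e.f v).card) _
      ((2 * n) ^ 2) (1 + ε) fun μ hμ hμ1 => ?_
    -- With `k = ⌈K⌉₊`, the factor `(2 * n) ^ (1 / k)` is at most `2 ^ (ε / 2) ≤ 1 + ε / 2`.
    -- Moreover `k ≤ 5 * log n / ε`, whence `12800 = 5 * 2560`.
    set K : ℝ := 2 * Real.logb 2 (2 * n : ℝ) / ε with hK
    have hK1 : 1 ≤ K := by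
      rw [hK, le_div_iff₀ hε]
      linarith
    have hk : 1 ≤ ⌈K⌉₊ := Nat.one_le_ceil_iff.2 (by linarith)
    obtain ⟨e, he, hA, hsize⟩ := exists_spanningClanTree_of_weighting G hG hcard hn hk hμ hμ1
    refine ⟨e, hasMultDistortion_mono G ?_ he, hA, ?_⟩
    · have h1 := Nat.ceil_lt_add_one (zero_le_one.trans hK1)
      have h2 : (⌈K⌉₊ : ℝ) ≤ 5 * (Real.logb 2 n / ε) := by
        have h3 : K ≤ 4 * (Real.logb 2 n / ε) := by
          rw [hK, h2n, ← mul_div_assoc]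
          exact div_le_div_of_nonneg_right (by linarith) hε.le
        have h4 : 1 ≤ Real.logb 2 n / ε := by
          rw [le_div_iff₀ hε]
          linarith
        linarith
      have h3 := mul_le_mul_of_nonneg_right h2 (by linarith : 0 ≤ Real.logb 2 (Real.logb 2 n))
      rw [mul_div_right_comm]
      linarith
    · have h1 : (2 * n : ℝ) ^ (1 / (⌈K⌉₊ : ℝ)) ≤ 1 + ε / 2 := by
        have hceil : (0 : ℝ) < ⌈K⌉₊ := by exact_mod_cast hk
        have h2 : (2 * n : ℝ) = 2 ^ Real.logb 2 (2 * n : ℝ) :=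
          (Real.rpow_logb (by norm_num) (by norm_num) (by linarith)).symm
        rw [h2, ← Real.rpow_mul (by norm_num)]
        have h3 : Real.logb 2 (2 * n : ℝ) * (1 / (⌈K⌉₊ : ℝ)) ≤ ε / 2 := by
          rw [mul_one_div, div_le_iff₀ hceil]
          have h4 := mul_le_mul_of_nonneg_left (Nat.le_ceil K) (by linarith : 0 ≤ ε / 2)
          have h5 : ε / 2 * K = Real.logb 2 (2 * n : ℝ) := by
            rw [hK]
            field_simp
          linarith
        refine (Real.rpow_le_rpow_of_exponent_le (by norm_num) h3).trans ?_
        have h4 := rpow_one_add_le_one_add_mul_self (s := 1) (by norm_num)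
          (by linarith : 0 ≤ ε / 2) (by linarith)
        norm_num at h4
        linarith
      have h2 := mul_le_mul_of_nonneg_left h1 (by linarith : (0 : ℝ) ≤ 2 * n)
      have hone : ∀ v, (1 : ℝ) ≤ (e.f v).card := fun v => by
        exact_mod_cast (e.isClan.oneToMany.nonempty v).card_pos
      -- Every clan is nonempty, so the uniform summand of the weights uses up at least `n` of the
      -- budget `2 * n + n * ε`. What remains is `n * (1 + ε)`, giving leading constant 1 instead of
      -- 2.
      have h3 : (n : ℝ) ≤ ∑ v, ((e.f v).card : ℝ) := by
        have := Finset.sum_le_sum fun v (_ : v ∈ Finset.univ) => hone v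
        simpa [hcard] using this
      simp only [add_mul, one_mul, Finset.sum_add_distrib, mul_assoc, ← Finset.mul_sum] at hsize
      have h4 : n * ∑ v, μ v * ((e.f v).card : ℝ) ≤ n * (1 + ε) := by linarith
      exact le_of_mul_le_mul_left h4 (by linarith)
  · refine exists_pmf_expectation_le (fun (e : SpanningClanTree G) v => (e.f v).card) _
      ((2 * n) ^ 2) _ fun μ hμ hμ1 => ?_
    obtain ⟨e, he, hA, hsize⟩ := exists_spanningClanTree_of_weighting G hG hcard hn hk hμ hμ1
    have hk' : (1 : ℝ) ≤ k := by exact_mod_cast hk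
    refine ⟨e, hasMultDistortion_mono G ?_ he, hA, ?_⟩
    · have : 0 ≤ k * Real.logb 2 (Real.logb 2 n) := mul_nonneg (by linarith) (by linarith)
      linarith
    · have h1 : (2 * n : ℝ) ^ (1 / (k : ℝ)) ≤ 2 * (n : ℝ) ^ (1 / (k : ℝ)) := by
        rw [Real.mul_rpow (by norm_num) (by linarith)]
        refine mul_le_mul_of_nonneg_right ?_ (by positivity)
        refine (Real.rpow_le_rpow_of_exponent_le (by norm_num) ?_).trans_eq (Real.rpow_one _)
        rw [div_le_one (by linarith)]
        exact hk'
      have h2 := mul_le_mul_of_nonneg_left h1 (by linarith : (0 : ℝ) ≤ 2 * n)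
      have h3 : (0 : ℝ) ≤ ∑ v, ((e.f v).card : ℝ) :=
        Finset.sum_nonneg fun v _ => Nat.cast_nonneg _
      simp only [add_mul, one_mul, Finset.sum_add_distrib, mul_assoc, ← Finset.mul_sum] at hsize
      have h5 : 0 ≤ (n : ℝ) * (n : ℝ) ^ (1 / (k : ℝ)) := by positivity
      have h4 : n * ∑ v, μ v * ((e.f v).card : ℝ) ≤ n * (12800 * (n : ℝ) ^ (1 / (k : ℝ))) := by
        linarith
      exact le_of_mul_le_mul_left h4 (by linarith)
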